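/- Let $s,b\in\mathbb R$ with $27s-38b^2>0$ and $b\neq 0$, let $\varepsilon>0$ and $\omega\in(-\tfrac12,\tfrac12)$ with $1+2\varepsilon\omega>0$, and let $\tilde u=\tilde u(x)$ be a roll, that is, an even, $2\pi$-periodic, real-valued $C^4$ function solving $$-(1+(1+2\varepsilon\omega)\partial_x^2)^2\tilde u+\varepsilon^2\tilde u+b\tilde u^2-s\tilde u^3=0 .$$ Let $$\mathcal L=-(1+(1+2\varepsilon\omega)\partial_x^2+\partial_y^2)^2+\varepsilon^2+2b\tilde u-3s\tilde u^2$$ act on $L^2(\mathbb R^2;\mathbb C)$ with domain $H^4(\mathbb R^2)$, and for $\sigma=(\sigma_1,\sigma_2)\in\mathbb R^2$ let $$B(\sigma)=-\big[1+(1+2\varepsilon\omega)(\partial_x+i\sigma_1)^2-\sigma_2^2\big]^2+\varepsilon^2+2b\tilde u-3s\tilde u^2$$ act on $L^2(\mathbb T;\mathbb C)$, $\mathbb T=\mathbb R/2\pi\mathbb Z$, with domain $H^4(\mathbb T)$. Then the set of all (real) eigenvalues of the operators $B(\sigma)$, $\sigma\in\mathbb R^2$, is non-empty and bounded above; let $\lambda_M$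 be its supremum (the maximal growth rate, equal to the largest eigenvalue when it is attained). The operator $\mathcal L$ generates a strongly continuous semigroup $(e^{t\mathcal L})_{t\ge 0}$ on $L^2(\mathbb R^2)$, this semigroup maps $H^2(\mathbb R^2)$ into itself, and there is a constant $C$ (which may depend on $s,b,\varepsilon,\omega,\tilde u$, but not on $t$ or $w$) such that $$\|e^{t\mathcal L}w\|_{H^2(\mathbb R^2)}\le C e^{\lambda_M t}\|w\|_{H^2(\mathbb R^2)}\qquad\text{for all } t\ge 0 \text{ and all } w\in H^2(\mathbb R^2).$$ -/

import Mathlib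

open MeasureTheory Filter Topology
open scoped NNReal ENNReal SchwartzMap LineDeriv

noncomputable section

namespace SwiftHohenberg

/-! ### Roll solutions -/

/-- `u` is a roll profile: an even, `2π`-periodic stationary solution, depending on `x` only, of
`∂ₜ u = -(1 + (1 + 2εω)∂ₓ² + ∂_y²)² u + ε² u + b u² - s u³`. -/
structure IsRoll (s b ε ω : ℝ) (u : ℝ → ℝ) : Prop where
  contDiff : ContDiff ℝ 4 u
  periodic : Function.Periodic u (2 * Real.pi)
  even : ∀ x, u (-x) = u x
  stationary : ∀ x,
    -(u x + 2 * (1 + 2 * ε * ω) * iteratedDeriv 2 u x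
        + (1 + 2 * ε * ω) ^ 2 * iteratedDeriv 4 u x)
      + ε ^ 2 * u x + b * u x ^ 2 - s * u x ^ 3 = 0

/-- The zeroth-order coefficient `ε² + 2b u - 3s u²` of the linearization about `u`. -/
def potential (s b ε : ℝ) (u : ℝ → ℝ) (x : ℝ) : ℝ :=
  ε ^ 2 + 2 * b * u x - 3 * s * u x ^ 2

/-! ### The plane: Sobolev spaces and the linearized operator -/

/-- The plane with coordinates `(x, y) = (z 0, z 1)`. -/
abbrev Plane : Type := EuclideanSpace ℝ (Fin 2)

/-- `L²(ℝ²; ℂ)`. -/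
abbrev L2Plane : Type := Lp ℂ 2 (volume : Measure Plane)

/-- `w ∈ Hᵖ(ℝ²)`, for `w ∈ L²(ℝ²)`. -/
def MemH (p : ℝ) (w : L2Plane) : Prop :=
  TemperedDistribution.MemSobolev p 2 (w : 𝓢'(Plane, ℂ))

open Classical in
/-- The norm of `Hᵖ(ℝ²)`: the `L²` norm of the (unique) `L²` function that represents the
Bessel potential of order `p` of `w`, that is, of `(1 + |ξ|²)^(p/2) ŵ(ξ)`. Only meaningful for
`w ∈ Hᵖ(ℝ²)`; set to `0` otherwise. -/
def normH (p : ℝ) (w : L2Plane) : ℝ :=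
  if h : MemH p w then ‖h.choose‖ else 0

/-- The operator `1 + (1 + 2εω)∂ₓ² + ∂_y²` on tempered distributions. -/
def opA (ε ω : ℝ) (f : 𝓢'(Plane, ℂ)) : 𝓢'(Plane, ℂ) :=
  f + ((1 + 2 * ε * ω : ℝ) : ℂ) •
      ∂_{EuclideanSpace.single (0 : Fin 2) (1 : ℝ)}
        (∂_{EuclideanSpace.single (0 : Fin 2) (1 : ℝ)} f)
    + ∂_{EuclideanSpace.single (1 : Fin 2) (1 : ℝ)}
        (∂_{EuclideanSpace.single (1 : Fin 2) (1 : ℝ)} f)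

/-- The graph of the linearized operator
`ℒ = -(1 + (1 + 2εω)∂ₓ² + ∂_y²)² + ε² + 2b u - 3s u²` on `L²(ℝ²)` with domain `H⁴(ℝ²)`:
`w ∈ H⁴(ℝ²)` and `ℒ w = g`. The function `q` is the product of the potential with `w`. -/
def LinearizedGraph (s b ε ω : ℝ) (u : ℝ → ℝ) (w g : L2Plane) : Prop :=
  MemH 4 w ∧ ∃ q : L2Plane,
    (∀ᵐ z : Plane, q z = (potential s b ε u (z 0) : ℂ) * w z) ∧
    (g : 𝓢'(Plane, ℂ)) = -opA ε ω (opA ε ω (w : 𝓢'(Plane, ℂ))) + (q : 𝓢'(Plane, ℂ))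

/-! ### Strongly continuous semigroups -/

/-- `T` is a strongly continuous one-parameter semigroup of bounded operators on `X`. -/
structure IsC0Semigroup {X : Type*} [NormedAddCommGroup X] [NormedSpace ℂ X]
    (T : ℝ≥0 → X →L[ℂ] X) : Prop where
  zero : T 0 = ContinuousLinearMap.id ℂ X
  add : ∀ t r, T (t + r) = (T t).comp (T r)
  continuous : ∀ w, Continuous fun t => T t w

/-- The graph of the infinitesimal generator of `T`: the right derivative of `t ↦ T t w` at
`t = 0` exists and equals `g`. -/
def GeneratorGraph {X : Type*} [NormedAddCommGroup X] [NormedSpace ℂ X]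
    (T : ℝ≥0 → X →L[ℂ] X) (w g : X) : Prop :=
  Tendsto (fun t : ℝ≥0 => ((t : ℝ)⁻¹ : ℂ) • (T t w - w)) (𝓝[>] 0) (𝓝 g)

/-- `T t = e^{tℒ}`: `T` is the strongly continuous semigroup on `L²(ℝ²)` whose generator is
exactly `ℒ`, domain included. -/
def IsLinearizedSemigroup (s b ε ω : ℝ) (u : ℝ → ℝ) (T : ℝ≥0 → L2Plane →L[ℂ] L2Plane) : Prop :=
  IsC0Semigroup T ∧ ∀ w g, GeneratorGraph T w g ↔ LinearizedGraph s b ε ω u w g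

/-! ### Bloch operators on the circle -/

instance factTwoPiPos : Fact (0 < 2 * Real.pi) := ⟨Real.two_pi_pos⟩

/-- The circle `𝕋 = ℝ / 2πℤ`. -/
abbrev Circle2Pi : Type := AddCircle (2 * Real.pi)

/-- `L²(𝕋; ℂ)`. -/
abbrev L2Circle : Type := Lp ℂ 2 (AddCircle.haarAddCircle (T := 2 * Real.pi))

/-- `W ∈ H⁴(𝕋)`. -/
def MemH4Circle (W : L2Circle) : Prop :=
  Summable fun n : ℤ => (1 + (n : ℝ) ^ 2) ^ 4 * ‖fourierCoeff W n‖ ^ 2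

/-- The symbol of `-[1 + (1 + 2εω)(∂ₓ + iσ₁)² - σ₂²]²` at `e^{inx}`, where `∂ₓ` acts as `in`. -/
def blochSymbol (ε ω : ℝ) (σ : ℝ × ℝ) (n : ℤ) : ℂ :=
  -(1 + ((1 + 2 * ε * ω : ℝ) : ℂ) * (Complex.I * n + Complex.I * σ.1) ^ 2 - (σ.2 : ℂ) ^ 2) ^ 2

/-- The graph of the Bloch operator
`B(σ) = -[1 + (1 + 2εω)(∂ₓ + iσ₁)² - σ₂²]² + ε² + 2b u - 3s u²` on `L²(𝕋)` with domain `H⁴(𝕋)`: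
`W ∈ H⁴(𝕋)` and `B(σ) W = G`, the equation being written in Fourier coefficients. The function
`Q` is the product of the potential with `W`. -/
def BlochGraph (s b ε ω : ℝ) (u : ℝ → ℝ) (σ : ℝ × ℝ) (W G : L2Circle) : Prop :=
  MemH4Circle W ∧ ∃ Q : L2Circle,
    (∀ᵐ θ ∂(AddCircle.haarAddCircle (T := 2 * Real.pi)),
      Q θ = ((AddCircle.liftIco (2 * Real.pi) 0 (potential s b ε u) θ : ℝ) : ℂ) * W θ) ∧
    ∀ n : ℤ, fourierCoeff G n = blochSymbol ε ω σ n * fourierCoeff W n + fourierCoeff Q n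

/-- The eigenvalues of all the Bloch operators `B(σ)`, `σ ∈ ℝ²`; they are real since each `B(σ)`
is self-adjoint. -/
def blochEigenvalues (s b ε ω : ℝ) (u : ℝ → ℝ) : Set ℝ :=
  {μ | ∃ σ : ℝ × ℝ, ∃ W : L2Circle, W ≠ 0 ∧ BlochGraph s b ε ω u σ W ((μ : ℂ) • W)}

/-- The maximal growth rate `λ_M`: the supremum of the eigenvalues of the Bloch operators over all
`σ ∈ ℝ²`, which is the largest eigenvalue when it is attained. -/
def maxGrowthRate (s b ε ω : ℝ) (u : ℝ → ℝ) : ℝ :=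
  sSup (blochEigenvalues s b ε ω u)

end SwiftHohenberg

end

noncomputable section

set_option linter.unusedSectionVars false

namespace SwiftHohenberg

/-! ### The resolvent of a form-bounded perturbation -/

section Resolvent

/-! Let A be the operator 1 + (1+2εω)∂ₓ² + ∂_y², let V be multiplication by the potential, |V| ≤ C,
and take κ = 2C + 1. Put N = (A² + κ)^(-1/2), a Fourier multiplier with range H² whose square has
range H⁴. Since ‖V‖‖N‖² ≤ 1/2, the operator R = (κ - ℒ)⁻¹ = N²(1 - VN²)⁻¹ exists and is bounded,
positive and injective, so that e^{tℒ} = e^{κt} exp(-tR⁻¹) is available from the continuous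
functional calculus of R. Uniqueness of the semigroup is a Gronwall argument
(`IsC0Semigroup.eq_of_generatorGraph`).

The H² bound has no loss in the exponent because it is an L² bound in disguise. For w = Rg, the form
⟨Rg, g⟩ = ‖N⁻¹w‖² - ⟨w, Vw⟩ is comparable to ‖N⁻¹w‖², that is, to the squared H² norm of w. It also
equals ‖R^(1/2)g‖², and R^(1/2) commutes with the semigroup, so the decay exp(-t/‖R‖) on L² passes
to H² (`exists_shiftedHeatSemigroup_apply_eq`). It remains to show ‖R‖ ≤ (κ - λ_M)⁻¹, which follows
from the form inequality ⟨ℒw, w⟩ ≤ λ_M‖w‖² (`IsRoll.plane_form_le`).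

On the circle, the analogous resolvent R_σ is compact and positive, so ‖R_σ‖ is an eigenvalue. Thus
κ - ‖R_σ‖⁻¹ is an eigenvalue of B(σ) that bounds its form, and the form of every B(σ) is at most λ_M
(`IsRoll.exists_blochEigenvalue_form_le`).

The passage to the plane uses averaging in place of a Bloch transform. For each frequency ξ, the
Bloch inequality is applied to the finite sequence of values of ŵ at K consecutive points ξ + n
e₁/(2π), and integrated over all ξ. By translation invariance the diagonal terms give K times the
plane quantities, while the potential gives a K by K Toeplitz sum of the terms c_j⟨w, e^{ijx}w⟩,
where c_j are the Fourier coefficients of V. Division by K and K → ∞ recover ⟨w, Vw⟩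
(`tendsto_window_average`), because (c_j) is summable. -/

theorem re_inner_self {H : Type*} [NormedAddCommGroup H] [InnerProductSpace ℂ H] (x : H) :
    (inner ℂ x x).re = ‖x‖ ^ 2 :=
  inner_self_eq_norm_sq (𝕜 := ℂ) x

variable {H : Type*} [NormedAddCommGroup H] [InnerProductSpace ℂ H] [CompleteSpace H]

/-- The operator `(M⁻¹ - V)⁻¹` with `M = N²`, written as `M (1 - V M)⁻¹`. -/
def perturbedResolvent (N V : H →L[ℂ] H) : H →L[ℂ] H :=
  N * N * Ring.inverse (1 - V * (N * N))

variable {N V : H →L[ℂ] H}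

theorem isUnit_one_sub_perturbation (hNV : ‖V‖ * ‖N‖ ^ 2 ≤ 1 / 2) :
    IsUnit (1 - V * (N * N)) := by
  apply isUnit_one_sub_of_norm_lt_one
  calc ‖V * (N * N)‖ ≤ ‖V‖ * (‖N‖ * ‖N‖) :=
        (norm_mul_le _ _).trans (by gcongr; exact norm_mul_le _ _)
    _ < 1 := by nlinarith

theorem perturbedResolvent_apply_sub (hNV : ‖V‖ * ‖N‖ ^ 2 ≤ 1 / 2) (h : H) :
    perturbedResolvent N V (h - V (N (N h))) = N (N h) := by
  have h1 : perturbedResolvent N V * (1 - V * (N * N)) = N * N := by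
    rw [perturbedResolvent, mul_assoc, Ring.inverse_mul_cancel _ (isUnit_one_sub_perturbation hNV),
      mul_one]
  have := congrArg (fun A : H →L[ℂ] H => A h) h1
  simpa using this

/-- Every g can thus be written as h - VN²h, and then its image under the resolvent is N²h. All
properties of the resolvent are verified in this parametrization. -/
theorem exists_sub_perturbation_eq (hNV : ‖V‖ * ‖N‖ ^ 2 ≤ 1 / 2) (g : H) :
    ∃ h, h - V (N (N h)) = g := by
  refine ⟨Ring.inverse (1 - V * (N * N)) g, ?_⟩
  have h1 := Ring.mul_inverse_cancel _ (isUnit_one_sub_perturbation hNV)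
  have := congrArg (fun A : H →L[ℂ] H => A g) h1
  simpa using this

theorem eq_perturbedResolvent_iff (hNV : ‖V‖ * ‖N‖ ^ 2 ≤ 1 / 2) {w g : H} :
    w = perturbedResolvent N V g ↔ ∃ h, w = N (N h) ∧ g = h - V w := by
  constructor
  · rintro rfl
    obtain ⟨h, rfl⟩ := exists_sub_perturbation_eq hNV g
    exact ⟨h, perturbedResolvent_apply_sub hNV h, by rw [perturbedResolvent_apply_sub hNV h]⟩
  · rintro ⟨h, rfl, rfl⟩
    exact (perturbedResolvent_apply_sub hNV h).symm

theorem inner_apply_comm_of_isSelfAdjoint {A : H →L[ℂ] H} (hA : IsSelfAdjoint A) (x y : H) :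
    inner ℂ (A x) y = inner ℂ x (A y) :=
  hA.isSymmetric x y

theorem isSelfAdjoint_perturbedResolvent (hN : IsSelfAdjoint N) (hV : IsSelfAdjoint V)
    (hNV : ‖V‖ * ‖N‖ ^ 2 ≤ 1 / 2) : IsSelfAdjoint (perturbedResolvent N V) := by
  rw [ContinuousLinearMap.isSelfAdjoint_iff_isSymmetric]
  intro g g'
  obtain ⟨h, rfl⟩ := exists_sub_perturbation_eq hNV g
  obtain ⟨h', rfl⟩ := exists_sub_perturbation_eq hNV g'
  rw [ContinuousLinearMap.coe_coe, perturbedResolvent_apply_sub hNV,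
    perturbedResolvent_apply_sub hNV, inner_sub_left, inner_sub_right]
  simp only [inner_apply_comm_of_isSelfAdjoint hV, inner_apply_comm_of_isSelfAdjoint hN]

/-- With w = N²h this is the form ⟨(N⁻² - V)w, w⟩, since Nh = N⁻¹w. It links the resolvent to the
energy norm ‖N⁻¹w‖. -/
theorem inner_perturbedResolvent_eq (hN : IsSelfAdjoint N) (hNV : ‖V‖ * ‖N‖ ^ 2 ≤ 1 / 2) (h : H) :
    (inner ℂ (perturbedResolvent N V (h - V (N (N h)))) (h - V (N (N h)))).re =
      ‖N h‖ ^ 2 - (inner ℂ (N (N h)) (V (N (N h)))).re := by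
  rw [perturbedResolvent_apply_sub hNV, inner_sub_right, Complex.sub_re,
    inner_apply_comm_of_isSelfAdjoint hN (N h) h, re_inner_self]

/-- Applied to v = Nh, it keeps the form between 1/2 and 3/2 of ‖Nh‖². The lower bound gives
positivity of the resolvent, and both together the equivalence of the form norm with the norm ‖Nh‖.
-/
theorem abs_inner_perturbation_le (hNV : ‖V‖ * ‖N‖ ^ 2 ≤ 1 / 2) (v : H) :
    |(inner ℂ (N v) (V (N v))).re| ≤ ‖v‖ ^ 2 / 2 := by
  calc |(inner ℂ (N v) (V (N v))).re| ≤ ‖inner ℂ (N v) (V (N v))‖ := Complex.abs_re_le_norm _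
    _ ≤ ‖N v‖ * ‖V (N v)‖ := norm_inner_le_norm _ _
    _ ≤ (‖N‖ * ‖v‖) * (‖V‖ * (‖N‖ * ‖v‖)) := by
        gcongr
        · exact N.le_opNorm v
        · exact (V.le_opNorm _).trans (by gcongr; exact N.le_opNorm v)
    _ = (‖V‖ * ‖N‖ ^ 2) * ‖v‖ ^ 2 := by ring
    _ ≤ (1 / 2) * ‖v‖ ^ 2 := by gcongr
    _ = _ := by ring

theorem perturbedResolvent_nonneg (hN : IsSelfAdjoint N) (hV : IsSelfAdjoint V)
    (hNV : ‖V‖ * ‖N‖ ^ 2 ≤ 1 / 2) : 0 ≤ perturbedResolvent N V := by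
  rw [ContinuousLinearMap.nonneg_iff_isPositive, ContinuousLinearMap.isPositive_def]
  refine ⟨ContinuousLinearMap.isSelfAdjoint_iff_isSymmetric.1
    (isSelfAdjoint_perturbedResolvent hN hV hNV), fun g => ?_⟩
  obtain ⟨h, rfl⟩ := exists_sub_perturbation_eq hNV g
  rw [ContinuousLinearMap.reApplyInnerSelf_apply]
  have := inner_perturbedResolvent_eq (V := V) hN hNV h
  have h2 := abs_le.1 (abs_inner_perturbation_le hNV (N h))
  change 0 ≤ (inner ℂ _ _).re
  nlinarith [sq_nonneg ‖N h‖]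

theorem injective_perturbedResolvent (hinj : Function.Injective N)
    (hNV : ‖V‖ * ‖N‖ ^ 2 ≤ 1 / 2) : Function.Injective (perturbedResolvent N V) := by
  intro g g' hgg
  obtain ⟨h, rfl⟩ := exists_sub_perturbation_eq hNV g
  obtain ⟨h', rfl⟩ := exists_sub_perturbation_eq hNV g'
  rw [perturbedResolvent_apply_sub hNV, perturbedResolvent_apply_sub hNV] at hgg
  rw [hinj (hinj hgg)]

theorem denseRange_of_isSelfAdjoint {A : H →L[ℂ] H} (hA : IsSelfAdjoint A)
    (hinj : Function.Injective A) : DenseRange A := by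
  have h1 : (A : H →ₗ[ℂ] H).rangeᗮ = ⊥ := by
    rw [ContinuousLinearMap.orthogonal_range, ContinuousLinearMap.isSelfAdjoint_iff'.1 hA]
    exact LinearMap.ker_eq_bot.2 hinj
  have h2 := (Submodule.topologicalClosure_eq_top_iff (K := (A : H →ₗ[ℂ] H).range)).2 h1
  have h3 := (Submodule.dense_iff_topologicalClosure_eq_top).2 h2
  exact h3

end Resolvent

/-! ### The contraction semigroup generated by `-R⁻¹` -/

section Semigroup

variable {H : Type*} [NormedAddCommGroup H] [InnerProductSpace ℂ H] [CompleteSpace H]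

/-- The function `r ↦ exp (-t / r)` on `[0, ∞)`, constant `1` for `t = 0`. -/
def heatSymbol (t : ℝ≥0) (r : ℝ) : ℝ :=
  if t = 0 then 1 else expNegInvGlue (r / t)

/-- For t > 0 the extension by 0 is continuous at r = 0, which lies in the spectrum of R when R⁻¹ is
unbounded. So exp(-tR⁻¹) is a continuous function of the bounded operator R. -/
theorem continuous_heatSymbol (t : ℝ≥0) : Continuous (heatSymbol t) := by
  unfold heatSymbol
  split_ifs
  · exact continuous_const
  · exact (expNegInvGlue.contDiff (n := 0)).continuous.comp (continuous_id.div_const _)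

theorem heatSymbol_of_pos (t : ℝ≥0) {r : ℝ} (hr : 0 < r) :
    heatSymbol t r = Real.exp (-(t / r)) := by
  unfold heatSymbol
  split_ifs with h
  · simp [h]
  · have ht : (0 : ℝ) < t := by exact_mod_cast pos_iff_ne_zero.2 h
    rw [expNegInvGlue, if_neg (not_le.2 (div_pos hr ht)), inv_div]

theorem heatSymbol_of_nonpos {t : ℝ≥0} (ht : t ≠ 0) {r : ℝ} (hr : r ≤ 0) :
    heatSymbol t r = 0 := by
  rw [heatSymbol, if_neg ht, expNegInvGlue.zero_of_nonpos]
  exact div_nonpos_of_nonpos_of_nonneg hr t.2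

theorem heatSymbol_add (t t' : ℝ≥0) (r : ℝ) :
    heatSymbol (t + t') r = heatSymbol t r * heatSymbol t' r := by
  rcases eq_or_ne t 0 with rfl | ht
  · simp [heatSymbol]
  rcases eq_or_ne t' 0 with rfl | ht'
  · simp [heatSymbol]
  rcases lt_or_ge 0 r with hr | hr
  · rw [heatSymbol_of_pos _ hr, heatSymbol_of_pos _ hr, heatSymbol_of_pos _ hr, ← Real.exp_add]
    push_cast
    ring_nf
  · rw [heatSymbol_of_nonpos (by simp [ht]) hr, heatSymbol_of_nonpos ht hr, zero_mul]

theorem abs_heatSymbol_le (t : ℝ≥0) {r ρ : ℝ} (hr : r ≤ ρ) :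
    |heatSymbol t r| ≤ Real.exp (-(t / ρ)) := by
  rcases lt_or_ge 0 r with hr0 | hr0
  · rw [heatSymbol_of_pos _ hr0, abs_of_pos (Real.exp_pos _)]
    gcongr
  · rcases eq_or_ne t 0 with rfl | ht
    · simp [heatSymbol]
    · rw [heatSymbol_of_nonpos ht hr0]
      simp [Real.exp_nonneg]

theorem abs_heatSymbol_le_one (t : ℝ≥0) (r : ℝ) : |heatSymbol t r| ≤ 1 := by
  rcases lt_or_ge 0 r with hr | hr
  · exact (abs_heatSymbol_le t le_rfl).trans (Real.exp_le_one_iff.2 (by simp; positivity))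
  · exact (abs_heatSymbol_le t (hr.trans zero_le_one)).trans
      (Real.exp_le_one_iff.2 (by simp))

/-- This is 1 - e^(-x) ≤ x for x = t/r, multiplied by r. It controls the semigroup at small times on
the range of R. -/
theorem abs_sub_one_mul_le (t : ℝ≥0) {r : ℝ} (hr : 0 ≤ r) :
    |(heatSymbol t r - 1) * r| ≤ t := by
  rcases hr.eq_or_lt with rfl | hr
  · simp
  rw [heatSymbol_of_pos _ hr]
  have h1 : -(t / r) + 1 ≤ Real.exp (-(t / r)) := Real.add_one_le_exp _
  have h2 : Real.exp (-(t / r)) ≤ 1 := Real.exp_le_one_iff.2 (by simp; positivity)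
  rw [abs_of_nonpos (mul_nonpos_of_nonpos_of_nonneg (by linarith) hr.le)]
  have h3 : (t : ℝ) / r * r = t := by field_simp
  nlinarith

/-- This is 0 ≤ e^(-x) - 1 + x ≤ x² for x = t/r, multiplied by r². It identifies the derivative at
time zero on the range of R². -/
theorem abs_sub_one_mul_add_mul_le (t : ℝ≥0) {r : ℝ} (hr : 0 ≤ r) :
    |((heatSymbol t r - 1) * r + t) * r| ≤ t ^ 2 := by
  rcases hr.eq_or_lt with rfl | hr
  · simp
  rw [heatSymbol_of_pos _ hr]
  set x : ℝ := t / r with hx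
  have ht : (t : ℝ) = x * r := by rw [hx]; field_simp
  have hx0 : 0 ≤ x := by positivity
  have h1 : -x + 1 ≤ Real.exp (-x) := Real.add_one_le_exp _
  have h2 : Real.exp (-x) ≤ 1 - x + x ^ 2 := by
    have h3 : Real.exp (-x) * (x + 1) ≤ 1 := by
      calc Real.exp (-x) * (x + 1) ≤ Real.exp (-x) * Real.exp x := by
            gcongr; exact Real.add_one_le_exp x
        _ = 1 := by rw [← Real.exp_add]; simp
    -- The bound e^(-x) ≤ 1/(1 + x) suffices because (1 + x)(1 - x + x²) = 1 + x³ ≥ 1.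
    have h4 : 0 ≤ x ^ 3 := by positivity
    by_contra hc
    push Not at hc
    nlinarith
  rw [ht, show ((Real.exp (-x) - 1) * r + x * r) * r = (Real.exp (-x) - 1 + x) * r ^ 2 by ring,
    abs_of_nonneg (mul_nonneg (by linarith) (sq_nonneg r)), mul_pow]
  gcongr
  linarith

/-- The semigroup generated by `-R⁻¹`, for a positive injective operator `R`. -/
def heatSemigroup (R : H →L[ℂ] H) (t : ℝ≥0) : H →L[ℂ] H := cfc (heatSymbol t) R

variable {R : H →L[ℂ] H}

theorem spectrum_nonneg (hR : 0 ≤ R) {r : ℝ} (hr : r ∈ spectrum ℝ R) : 0 ≤ r :=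
  spectrum_nonneg_of_nonneg hR hr

theorem spectrum_le_norm {r : ℝ} (hr : r ∈ spectrum ℝ R) : r ≤ ‖R‖ := by
  rcases subsingleton_or_nontrivial (H →L[ℂ] H) with h | h
  · simp [spectrum.of_subsingleton] at hr
  · exact (le_abs_self r).trans (spectrum.norm_le_norm_of_mem hr)

theorem heatSemigroup_zero (hR : 0 ≤ R) : heatSemigroup R 0 = 1 := by
  have hsa : IsSelfAdjoint R := .of_nonneg hR
  have : heatSymbol 0 = fun _ => 1 := by ext; simp [heatSymbol]
  rw [heatSemigroup, this, cfc_const_one ℝ R]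

theorem heatSemigroup_add (t t' : ℝ≥0) :
    heatSemigroup R (t + t') = heatSemigroup R t * heatSemigroup R t' := by
  rw [heatSemigroup, heatSemigroup, heatSemigroup, ← cfc_mul _ _ R
    (continuous_heatSymbol t).continuousOn (continuous_heatSymbol t').continuousOn]
  congr 1
  ext r
  exact heatSymbol_add t t' r

theorem norm_heatSemigroup_le_one (t : ℝ≥0) : ‖heatSemigroup R t‖ ≤ 1 :=
  norm_cfc_le zero_le_one fun r _ => abs_heatSymbol_le_one t r

theorem norm_heatSemigroup_le {ρ : ℝ} (hRρ : ‖R‖ ≤ ρ) (t : ℝ≥0) :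
    ‖heatSemigroup R t‖ ≤ Real.exp (-(t / ρ)) :=
  norm_cfc_le (Real.exp_nonneg _) fun _ hr =>
    abs_heatSymbol_le t ((spectrum_le_norm hr).trans hRρ)

theorem commute_heatSemigroup (hR : 0 ≤ R) (t : ℝ≥0) : Commute (heatSemigroup R t) R := by
  have hsa : IsSelfAdjoint R := .of_nonneg hR
  have := cfc_commute_cfc (heatSymbol t) (id : ℝ → ℝ) R
  rwa [cfc_id ℝ R] at this

theorem norm_heatSemigroup_sub_one_mul_le (hR : 0 ≤ R) (t : ℝ≥0) :
    ‖(heatSemigroup R t - 1) * R‖ ≤ t := by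
  have hsa : IsSelfAdjoint R := .of_nonneg hR
  have hc := (continuous_heatSymbol t).continuousOn (s := spectrum ℝ R)
  have : (heatSemigroup R t - 1) * R = cfc (fun r => (heatSymbol t r - 1) * r) R := by
    rw [cfc_mul _ _ R (by fun_prop) (by fun_prop), cfc_sub _ _ R hc (by fun_prop),
      cfc_const_one ℝ R, cfc_id' ℝ R, heatSemigroup]
  rw [this]
  exact norm_cfc_le t.2 fun r hr => abs_sub_one_mul_le t (spectrum_nonneg hR hr)

theorem norm_heatSemigroup_sub_one_mul_add_mul_le (hR : 0 ≤ R) (t : ℝ≥0) :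
    ‖((heatSemigroup R t - 1) * R + algebraMap ℝ (H →L[ℂ] H) t) * R‖ ≤ t ^ 2 := by
  have hsa : IsSelfAdjoint R := .of_nonneg hR
  have hc := (continuous_heatSymbol t).continuousOn (s := spectrum ℝ R)
  have : ((heatSemigroup R t - 1) * R + algebraMap ℝ (H →L[ℂ] H) t) * R =
      cfc (fun r => ((heatSymbol t r - 1) * r + t) * r) R := by
    rw [cfc_mul _ _ R (by fun_prop) (by fun_prop), cfc_add R _ _ (by fun_prop) (by fun_prop),
      cfc_mul _ _ R (by fun_prop) (by fun_prop), cfc_sub _ _ R hc (by fun_prop),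
      cfc_const_one ℝ R, cfc_id' ℝ R, cfc_const _ R, heatSemigroup]
  rw [this]
  exact norm_cfc_le (by positivity)
    fun r hr => abs_sub_one_mul_add_mul_le t (spectrum_nonneg hR hr)

end Semigroup

end SwiftHohenberg

namespace SwiftHohenberg

/-! ### Generators of semigroups and uniqueness of the semigroup with a given generator -/

section Generator

variable {X : Type*} [NormedAddCommGroup X] [NormedSpace ℂ X] {T : ℝ≥0 → X →L[ℂ] X}

theorem GeneratorGraph.sub {w w' g g' : X} (h : GeneratorGraph T w g)
    (h' : GeneratorGraph T w' g') : GeneratorGraph T (w - w') (g - g') := by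
  refine (Tendsto.sub h h').congr fun t => ?_
  rw [← smul_sub, map_sub]
  congr 1
  abel

theorem GeneratorGraph.map_of_commute {w g : X} (h : GeneratorGraph T w g) {A : X →L[ℂ] X}
    (hA : ∀ t x, T t (A x) = A (T t x)) : GeneratorGraph T (A w) (A g) := by
  refine ((A.continuous.tendsto g).comp h).congr fun t => ?_
  simp [hA]

theorem GeneratorGraph.unique {w g g' : X} (h : GeneratorGraph T w g)
    (h' : GeneratorGraph T w g') : g = g' := by
  have : (𝓝[>] (0 : ℝ≥0)).NeBot := inferInstance
  exact tendsto_nhds_unique h h'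

theorem tendsto_coe_nhdsGT_zero :
    Tendsto (fun t : ℝ≥0 => (t : ℝ)) (𝓝[>] 0) (𝓝[>] 0) := by
  refine tendsto_nhdsWithin_iff.2 ⟨?_, ?_⟩
  · have := (NNReal.continuous_coe.tendsto 0)
    simp only [NNReal.coe_zero] at this
    exact this.mono_left nhdsWithin_le_nhds
  · filter_upwards [self_mem_nhdsWithin] with t ht
    exact ht

theorem tendsto_coe_nnreal_zero : Tendsto (fun t : ℝ≥0 => (t : ℝ)) (𝓝[>] 0) (𝓝 0) :=
  tendsto_coe_nhdsGT_zero.mono_right nhdsWithin_le_nhds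

/-- Multiplying a semigroup by `exp (κ t)` adds `κ` to its generator. -/
theorem GeneratorGraph.exp_smul {w g : X} (h : GeneratorGraph T w g) (κ : ℝ) :
    GeneratorGraph (fun t : ℝ≥0 => ((Real.exp (κ * t) : ℝ) : ℂ) • T t) w (g + (κ : ℂ) • w) := by
  have h1 : Tendsto (fun t : ℝ≥0 => ((Real.exp (κ * t) : ℝ) : ℂ)) (𝓝[>] 0) (𝓝 1) := by
    have h2 : Tendsto (fun t : ℝ => ((Real.exp (κ * t) : ℝ) : ℂ)) (𝓝 0) (𝓝 1) := by
      have : Continuous fun t : ℝ => ((Real.exp (κ * t) : ℝ) : ℂ) := by fun_prop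
      simpa using this.tendsto 0
    exact h2.comp tendsto_coe_nnreal_zero
  have h3 : Tendsto (fun t : ℝ≥0 => ((t : ℝ)⁻¹ : ℂ) * (((Real.exp (κ * t) : ℝ) : ℂ) - 1))
      (𝓝[>] 0) (𝓝 κ) := by
    have hd : HasDerivAt (fun t : ℝ => Real.exp (κ * t)) κ 0 := by
      have := ((hasDerivAt_id (0 : ℝ)).const_mul κ).exp
      simpa using this
    have h4 := hd.tendsto_slope_zero_right
    have h5 := (Complex.continuous_ofReal.tendsto κ).comp (h4.comp tendsto_coe_nhdsGT_zero)
    refine h5.congr fun t => ?_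
    simp
  have h6 := (h1.smul h).add (h3.smul_const w)
  rw [one_smul] at h6
  refine h6.congr fun t => ?_
  simp only [_root_.smul_apply, smul_sub, mul_smul, sub_smul, one_smul]
  rw [smul_comm ((t : ℝ)⁻¹ : ℂ) _ w, smul_comm ((t : ℝ)⁻¹ : ℂ) _ (T t w)]
  abel

theorem IsC0Semigroup.exp_smul (hT : IsC0Semigroup T) (κ : ℝ) :
    IsC0Semigroup (fun t : ℝ≥0 => ((Real.exp (κ * t) : ℝ) : ℂ) • T t) where
  zero := by simp [hT.zero]
  add t r := by
    rw [hT.add]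
    ext x
    simp [mul_add, Real.exp_add, smul_smul, mul_comm]
  continuous w := by
    have h1 : Continuous fun t : ℝ≥0 => ((Real.exp (κ * t) : ℝ) : ℂ) := by fun_prop
    exact h1.smul (hT.continuous w)

theorem IsC0Semigroup.apply_add (hT : IsC0Semigroup T) (t r : ℝ≥0) (w : X) :
    T (t + r) w = T t (T r w) := by
  rw [hT.add]; rfl

theorem IsC0Semigroup.apply_comm (hT : IsC0Semigroup T) (t r : ℝ≥0) (w : X) :
    T t (T r w) = T r (T t w) := by
  rw [← hT.apply_add, add_comm, hT.apply_add]

/-- The right difference quotients of an orbit starting in the domain converge. -/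
theorem IsC0Semigroup.tendsto_slope (hT : IsC0Semigroup T) {w g : X} (h : GeneratorGraph T w g)
    (r : ℝ≥0) :
    Tendsto (fun t : ℝ≥0 => ((t : ℝ)⁻¹ : ℂ) • (T (r + t) w - T r w)) (𝓝[>] 0) (𝓝 (T r g)) := by
  refine (((T r).continuous.tendsto g).comp h).congr fun t => ?_
  simp [hT.apply_add]

/-- The difference quotients of `t ↦ ‖T t w‖²` type functions. -/
theorem tendsto_slope_norm_sq {H : Type*} [NormedAddCommGroup H] [InnerProductSpace ℂ H]
    {d : ℝ≥0 → H} (hd : Continuous d) {r : ℝ≥0} {e : H}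
    (h : Tendsto (fun t : ℝ≥0 => ((t : ℝ)⁻¹ : ℂ) • (d (r + t) - d r)) (𝓝[>] 0) (𝓝 e)) :
    Tendsto (fun t : ℝ≥0 => (t : ℝ)⁻¹ * (‖d (r + t)‖ ^ 2 - ‖d r‖ ^ 2)) (𝓝[>] 0)
      (𝓝 (2 * (inner ℂ e (d r)).re)) := by
  have h1 : Tendsto (fun t : ℝ≥0 => d (r + t)) (𝓝[>] 0) (𝓝 (d r)) := by
    have : Continuous fun t : ℝ≥0 => d (r + t) := hd.comp (by fun_prop)
    simpa using (this.tendsto 0).mono_left nhdsWithin_le_nhds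
  -- The real part of ⟨a - b, a + b⟩ is ‖a‖² - ‖b‖², because the cross terms cancel.
  have h2 := (Complex.continuous_re.tendsto _).comp (h.inner (h1.add_const (d r)))
  have h3 : (inner ℂ e (d r + d r)).re = 2 * (inner ℂ e (d r)).re := by
    rw [inner_add_right, Complex.add_re]; ring
  rw [h3] at h2
  refine h2.congr fun t => ?_
  simp only [Function.comp_apply]
  rw [inner_smul_left, inner_sub_left, inner_add_right, inner_add_right]
  have h4 : (inner ℂ (d r) (d (r + t))).re = (inner ℂ (d (r + t)) (d r)).re := by
    rw [← inner_conj_symm, Complex.conj_re]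
  simp only [Complex.conj_ofReal, ← Complex.ofReal_inv, Complex.re_ofReal_mul,
    Complex.sub_re, Complex.add_re, h4, re_inner_self]
  ring

/-- A strongly continuous semigroup on a Hilbert space is determined by its generator, if the
generator has dense domain and its quadratic form is bounded above. -/
theorem IsC0Semigroup.eq_of_generatorGraph {H : Type*} [NormedAddCommGroup H]
    [InnerProductSpace ℂ H] {T S : ℝ≥0 → H →L[ℂ] H} (hT : IsC0Semigroup T) (hS : IsC0Semigroup S)
    (hTS : ∀ w g, GeneratorGraph T w g ↔ GeneratorGraph S w g) {κ : ℝ}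
    (hκ : ∀ w g, GeneratorGraph S w g → (inner ℂ g w).re ≤ κ * ‖w‖ ^ 2)
    (hdense : Dense {w | ∃ g, GeneratorGraph S w g}) : T = S := by
  funext t
  refine ContinuousLinearMap.coeFn_injective
    (Continuous.ext_on hdense (T t).continuous (S t).continuous ?_)
  rintro w ⟨g, hg⟩
  have hg' := (hTS w g).2 hg
  let d : ℝ≥0 → H := fun r => T r w - S r w
  have hd : Continuous d := (hT.continuous w).sub (hS.continuous w)
  have hgraph : ∀ r, GeneratorGraph S (d r) (T r g - S r g) := fun r =>
    ((hTS _ _).1 (hg'.map_of_commute fun a x => hT.apply_comm a r x)).sub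
      (hg.map_of_commute fun a x => hS.apply_comm a r x)
  have hslope : ∀ r : ℝ≥0, Tendsto (fun t : ℝ≥0 => ((t : ℝ)⁻¹ : ℂ) • (d (r + t) - d r)) (𝓝[>] 0)
      (𝓝 (T r g - S r g)) := fun r => by
    refine ((hT.tendsto_slope hg' r).sub (hS.tendsto_slope hg r)).congr fun t => ?_
    rw [← smul_sub]
    congr 1
    simp only [d]
    abel
  -- The difference d of the two orbits solves the same evolution equation with d(0) = 0. Its
  -- squared norm has right derivative 2 Re⟨d', d⟩ ≤ 2κ‖d‖², so Gronwall's inequality forces d = 0.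
  -- Only right derivatives are at hand, and time is extended to ℝ by `Real.toNNReal`.
  let f : ℝ → ℝ := fun r => ‖d r.toNNReal‖ ^ 2
  let f' : ℝ → ℝ := fun r =>
    2 * (inner ℂ (T r.toNNReal g - S r.toNNReal g) (d r.toNNReal)).re
  have hf : Continuous f := by
    have : Continuous fun r : ℝ => d r.toNNReal := hd.comp continuous_real_toNNReal
    fun_prop
  have hbound := le_gronwallBound_of_liminf_deriv_right_le (f := f) (f' := f') (δ := 0)
    (K := 2 * κ) (ε := 0) (a := 0) (b := t) hf.continuousOn ?_ ?_ ?_ t ⟨t.2, le_rfl⟩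
  · rw [gronwallBound_ε0_δ0] at hbound
    have h0 : ‖d t‖ ^ 2 ≤ 0 := by simpa [f] using hbound
    have h1 : d t = 0 := by
      have := pow_eq_zero_iff (two_ne_zero) |>.1 (le_antisymm h0 (sq_nonneg _))
      exact norm_eq_zero.1 this
    exact sub_eq_zero.1 h1
  · intro x hx r hr
    have h1 := tendsto_slope_norm_sq hd (hslope x.toNNReal)
    have h2 : Tendsto (fun z : ℝ => (z - x).toNNReal) (𝓝[>] x) (𝓝[>] 0) := by
      refine tendsto_nhdsWithin_iff.2 ⟨?_, ?_⟩
      · have : Continuous fun z : ℝ => (z - x).toNNReal := by fun_prop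
        simpa using (this.tendsto x).mono_left nhdsWithin_le_nhds
      · filter_upwards [self_mem_nhdsWithin] with z hz
        simpa using hz
    have h3 := (h1.comp h2).eventually_lt_const hr
    refine Eventually.frequently ?_
    filter_upwards [h3, self_mem_nhdsWithin] with z hz hxz
    have hxz' : x < z := hxz
    have hx0 : 0 ≤ x := hx.1
    have h4 : x.toNNReal + (z - x).toNNReal = z.toNNReal := by
      rw [← Real.toNNReal_add hx0 (by linarith)]; congr 1; ring
    simp only [Function.comp_apply, h4, Real.coe_toNNReal _ (sub_nonneg.2 hxz'.le)] at hz
    exact hz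
  · simp [f, d, hT.zero, hS.zero]
  · intro x _
    have := hκ _ _ (hgraph x.toNNReal)
    simp only [f, f']
    linarith

end Generator

/-! ### Strong continuity and generator of exp(-tR⁻¹) -/

section HeatSemigroup

variable {H : Type*} [NormedAddCommGroup H] [InnerProductSpace ℂ H] [CompleteSpace H]
  {R : H →L[ℂ] H}

theorem heatSemigroup_apply_comm (hR : 0 ≤ R) (t : ℝ≥0) (x : H) :
    heatSemigroup R t (R x) = R (heatSemigroup R t x) :=
  congrArg (fun A : H →L[ℂ] H => A x) (commute_heatSemigroup hR t).eq

theorem norm_heatSemigroup_apply_le (t : ℝ≥0) (x : H) : ‖heatSemigroup R t x‖ ≤ ‖x‖ := by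
  simpa using (heatSemigroup R t).le_of_opNorm_le (norm_heatSemigroup_le_one t) x

/-- Uniformly bounded linear maps that converge on a dense range converge everywhere. -/
theorem tendsto_apply_of_denseRange {ι : Type*} {l : Filter ι} {A : ι → H →L[ℂ] H}
    {B : H →L[ℂ] H} {C : ℝ} (hA : ∀ i, ‖A i‖ ≤ C) (hR : DenseRange R)
    (h : ∀ x, Tendsto (fun i => A i (R x)) l (𝓝 (B (R x)))) (x : H) :
    Tendsto (fun i => A i x) l (𝓝 (B x)) := by
  rw [Metric.tendsto_nhds]
  intro ε hε
  have hC : 0 ≤ max C 0 := le_max_right _ _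
  set K : ℝ := max C 0 + ‖B‖ + 1 with hK
  have hK0 : 0 < K := by positivity
  obtain ⟨y, hy⟩ := hR.exists_dist_lt x (div_pos (half_pos hε) hK0)
  filter_upwards [Metric.tendsto_nhds.1 (h y) (ε / 2) (half_pos hε)] with i hi
  rw [dist_eq_norm] at *
  have h1 : A i x - B x = A i (x - R y) + (A i (R y) - B (R y)) - B (x - R y) := by
    simp only [map_sub]; abel
  have h2 : ‖A i (x - R y)‖ ≤ max C 0 * ‖x - R y‖ :=
    (A i).le_of_opNorm_le ((hA i).trans (le_max_left _ _)) _
  have h3 : ‖B (x - R y)‖ ≤ ‖B‖ * ‖x - R y‖ := B.le_opNorm _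
  have h4 : K * ‖x - R y‖ < ε / 2 := by
    rw [lt_div_iff₀ hK0] at hy; linarith
  calc ‖A i x - B x‖ ≤ ‖A i (x - R y)‖ + ‖A i (R y) - B (R y)‖ + ‖B (x - R y)‖ := by
        rw [h1]; exact (norm_sub_le _ _).trans (by gcongr; exact norm_add_le _ _)
    _ < ε := by nlinarith [norm_nonneg (x - R y)]

theorem tendsto_heatSemigroup_zero (hR : 0 ≤ R) (hd : DenseRange R) (x : H) :
    Tendsto (fun t => heatSemigroup R t x) (𝓝 0) (𝓝 x) := by
  refine tendsto_apply_of_denseRange (B := 1) norm_heatSemigroup_le_one hd (fun y => ?_) x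
  rw [tendsto_iff_norm_sub_tendsto_zero]
  refine squeeze_zero (g := fun t : ℝ≥0 => (t : ℝ) * ‖y‖) (fun _ => norm_nonneg _)
    (fun t => ?_) ?_
  · have := ((heatSemigroup R t - 1) * R).le_of_opNorm_le
      (norm_heatSemigroup_sub_one_mul_le hR t) y
    simpa using this
  · have : Continuous fun t : ℝ≥0 => (t : ℝ) * ‖y‖ := by fun_prop
    simpa using this.tendsto 0

theorem isC0Semigroup_heatSemigroup (hR : 0 ≤ R) (hd : DenseRange R) :
    IsC0Semigroup (heatSemigroup R) where
  zero := heatSemigroup_zero hR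
  add t r := heatSemigroup_add t r
  continuous w := by
    rw [continuous_iff_continuousAt]
    intro r
    rw [ContinuousAt, tendsto_iff_norm_sub_tendsto_zero]
    -- Contractivity reduces continuity at r to continuity at time zero; `max t r - min t r` is |t -
    -- r| inside `ℝ≥0`.
    have key : ∀ t : ℝ≥0, ‖heatSemigroup R t w - heatSemigroup R r w‖ ≤
        ‖heatSemigroup R (max t r - min t r) w - w‖ := by
      have aux : ∀ p q : ℝ≥0, p ≤ q → ‖heatSemigroup R q w - heatSemigroup R p w‖ ≤
          ‖heatSemigroup R (q - p) w - w‖ := fun p q hpq => by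
        have h1 : heatSemigroup R q w = heatSemigroup R p (heatSemigroup R (q - p) w) := by
          conv_lhs => rw [← add_tsub_cancel_of_le hpq, heatSemigroup_add]
          rfl
        rw [h1, ← map_sub]
        exact norm_heatSemigroup_apply_le p _
      intro t
      rcases le_total t r with h | h
      · rw [max_eq_right h, min_eq_left h, norm_sub_rev]
        exact aux t r h
      · rw [max_eq_left h, min_eq_right h]
        exact aux r t h
    refine squeeze_zero (fun _ => norm_nonneg _) key ?_
    have h1 : Tendsto (fun t : ℝ≥0 => max t r - min t r) (𝓝 r) (𝓝 0) := by
      have : Continuous fun t : ℝ≥0 => max t r - min t r := by fun_prop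
      simpa using this.tendsto r
    exact (tendsto_iff_norm_sub_tendsto_zero.1 (tendsto_heatSemigroup_zero hR hd w)).comp h1

/-- The difference quotients composed with R are bounded by 1, so their convergence to -1 need only
be checked on the dense range of R. There the initial value is R²y and the second-order estimate
leaves an error t‖y‖. -/
theorem generatorGraph_heatSemigroup_apply (hR : 0 ≤ R) (hd : DenseRange R) (x : H) :
    GeneratorGraph (heatSemigroup R) (R x) (-x) := by
  let A : ℝ≥0 → H →L[ℂ] H := fun t => ((t : ℝ)⁻¹ : ℂ) • ((heatSemigroup R t - 1) * R)
  have hA : ∀ t, ‖A t‖ ≤ 1 := fun t => by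
    rw [norm_smul, norm_inv, Complex.norm_real, Real.norm_of_nonneg t.coe_nonneg]
    have := norm_heatSemigroup_sub_one_mul_le hR t
    -- The bound includes t = 0, where the inverse is 0 by convention.
    calc (t : ℝ)⁻¹ * ‖(heatSemigroup R t - 1) * R‖ ≤ (t : ℝ)⁻¹ * t := by gcongr
      _ ≤ 1 := inv_mul_le_one
  have h := tendsto_apply_of_denseRange (l := 𝓝[>] 0) (A := A) (B := -1) hA hd (fun y => ?_) x
  · refine h.congr fun t => ?_
    simp [A]
  rw [tendsto_iff_norm_sub_tendsto_zero]
  refine squeeze_zero' (g := fun t : ℝ≥0 => (t : ℝ) * ‖y‖)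
    (Eventually.of_forall fun _ => norm_nonneg _) ?_ ?_
  · filter_upwards [self_mem_nhdsWithin] with t ht
    have ht0 : (0 : ℝ) < t := ht
    have h1 : A t (R y) - (-1 : H →L[ℂ] H) (R y) = ((t : ℝ)⁻¹ : ℂ) •
        (((heatSemigroup R t - 1) * R + algebraMap ℝ (H →L[ℂ] H) t) * R) y := by
      have h2 : (algebraMap ℝ (H →L[ℂ] H) t) (R y) = ((t : ℝ) : ℂ) • R y := by
        rw [Algebra.algebraMap_eq_smul_one, _root_.smul_apply, Complex.coe_smul]
        rfl
      have h3 : ((t : ℝ)⁻¹ : ℂ) • ((t : ℝ) : ℂ) • R y = R y := by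
        rw [smul_smul, inv_mul_cancel₀ (by exact_mod_cast ht0.ne'), one_smul]
      simp only [A, mul_apply_eq_comp, _root_.add_apply, smul_add, h2, h3,
        _root_.smul_apply, _root_.neg_apply, one_apply_eq_self, sub_neg_eq_add]
    rw [h1, norm_smul, norm_inv, Complex.norm_real, Real.norm_of_nonneg ht0.le]
    have h4 := (((heatSemigroup R t - 1) * R + algebraMap ℝ (H →L[ℂ] H) t) * R).le_of_opNorm_le
      (norm_heatSemigroup_sub_one_mul_add_mul_le hR t) y
    calc _ ≤ (t : ℝ)⁻¹ * (t ^ 2 * ‖y‖) := by gcongr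
      _ = t * ‖y‖ := by field_simp
  · simpa using tendsto_coe_nnreal_zero.mul_const ‖y‖

/-- The domain is no larger than the range of R: the generator sends z = w - R(-g) to 0, hence by
commutation also Rz to 0, but it sends Rz to -z. -/
theorem generatorGraph_heatSemigroup_iff (hR : 0 ≤ R)
    (hd : DenseRange R) {w g : H} :
    GeneratorGraph (heatSemigroup R) w g ↔ w = R (-g) := by
  constructor
  · intro h
    have h1 := (generatorGraph_heatSemigroup_apply hR hd (-g))
    rw [neg_neg] at h1
    have h2 := h.sub h1
    rw [sub_self] at h2
    have h3 := h2.map_of_commute (A := R) fun t x => heatSemigroup_apply_comm hR t x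
    have h4 := h3.unique (generatorGraph_heatSemigroup_apply hR hd (w - R (-g)))
    rw [map_zero] at h4
    exact sub_eq_zero.1 (neg_eq_zero.1 h4.symm)
  · rintro rfl
    have := generatorGraph_heatSemigroup_apply hR hd (-g)
    rwa [neg_neg] at this

/-- The semigroup generated by `κ - R⁻¹`. -/
def shiftedHeatSemigroup (R : H →L[ℂ] H) (κ : ℝ) (t : ℝ≥0) : H →L[ℂ] H :=
  ((Real.exp (κ * t) : ℝ) : ℂ) • heatSemigroup R t

theorem isC0Semigroup_shiftedHeatSemigroup (hR : 0 ≤ R) (hd : DenseRange R) (κ : ℝ) :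
    IsC0Semigroup (shiftedHeatSemigroup R κ) :=
  (isC0Semigroup_heatSemigroup hR hd).exp_smul κ

theorem generatorGraph_shiftedHeatSemigroup_iff (hR : 0 ≤ R)
    (hd : DenseRange R) {κ : ℝ} {w g : H} :
    GeneratorGraph (shiftedHeatSemigroup R κ) w g ↔ w = R ((κ : ℂ) • w - g) := by
  have hiff := generatorGraph_heatSemigroup_iff hR hd (w := w) (g := g - (κ : ℂ) • w)
  rw [neg_sub] at hiff
  rw [← hiff]
  constructor
  · intro h
    have h1 := GeneratorGraph.exp_smul h (-κ)
    have h2 : (fun t : ℝ≥0 => ((Real.exp (-κ * t) : ℝ) : ℂ) • shiftedHeatSemigroup R κ t) =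
        heatSemigroup R := by
      funext t
      rw [shiftedHeatSemigroup, smul_smul, ← Complex.ofReal_mul, ← Real.exp_add]
      simp
    rw [h2] at h1
    simpa [sub_eq_add_neg] using h1
  · intro h
    have h1 := GeneratorGraph.exp_smul h κ
    rw [sub_add_cancel] at h1
    exact h1

/-- Uniqueness of the semigroup generated by `κ - R⁻¹`. -/
theorem eq_shiftedHeatSemigroup (hR : 0 ≤ R)
    (hd : DenseRange R) {κ : ℝ} {T : ℝ≥0 → H →L[ℂ] H} (hT : IsC0Semigroup T)
    (hgen : ∀ w g, GeneratorGraph T w g ↔ w = R ((κ : ℂ) • w - g)) :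
    T = shiftedHeatSemigroup R κ := by
  refine hT.eq_of_generatorGraph (isC0Semigroup_shiftedHeatSemigroup hR hd κ)
    (fun w g => by rw [hgen, generatorGraph_shiftedHeatSemigroup_iff hR hd])
    (κ := κ) (fun w g h => ?_) ?_
  · rw [generatorGraph_shiftedHeatSemigroup_iff hR hd] at h
    have h1 : 0 ≤ (inner ℂ ((κ : ℂ) • w - g) w).re := by
      have := ((ContinuousLinearMap.nonneg_iff_isPositive R).1 hR).inner_nonneg_right
        ((κ : ℂ) • w - g)
      rw [← h] at this
      exact (Complex.le_def.1 this).1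
    rw [inner_sub_left, inner_smul_left, Complex.sub_re,
      Complex.conj_ofReal, Complex.re_ofReal_mul, re_inner_self] at h1
    linarith
  · refine Dense.mono ?_ hd
    rintro _ ⟨x, rfl⟩
    refine ⟨(κ : ℂ) • R x - x, ?_⟩
    rw [generatorGraph_shiftedHeatSemigroup_iff hR hd]
    simp

end HeatSemigroup

end SwiftHohenberg

namespace SwiftHohenberg

/-! ### Square roots of positive operators and the form norm -/

section SquareRoot

variable {H : Type*} [NormedAddCommGroup H] [InnerProductSpace ℂ H] [CompleteSpace H]
  {R : H →L[ℂ] H}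

/-- A positive operator has a self-adjoint square root that commutes with the semigroup. -/
theorem exists_sqrt (hR : 0 ≤ R) :
    ∃ P : H →L[ℂ] H, IsSelfAdjoint P ∧ P * P = R ∧ ∀ t, Commute (heatSemigroup R t) P := by
  have hsa : IsSelfAdjoint R := .of_nonneg hR
  refine ⟨cfc Real.sqrt R, cfc_predicate _ _, ?_, fun t => cfc_commute_cfc _ _ _⟩
  rw [← cfc_mul _ _ R (by fun_prop) (by fun_prop)]
  calc cfc (fun x => √x * √x) R = cfc (fun x : ℝ => x) R :=
        cfc_congr fun r hr => Real.mul_self_sqrt (spectrum_nonneg hR hr)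
    _ = R := cfc_id' ℝ R

theorem re_inner_eq_norm_sq_of_sqrt {P : H →L[ℂ] H} (hP : IsSelfAdjoint P) (hPR : P * P = R)
    (g : H) : (inner ℂ (R g) g).re = ‖P g‖ ^ 2 := by
  rw [← hPR, mul_apply_eq_comp, inner_apply_comm_of_isSelfAdjoint hP, re_inner_self]

/-- Since R = P² with P self-adjoint, ‖R‖ = ‖P‖² and ‖Rg‖ ≤ ‖P‖‖Pg‖. For injective R and w = Rg this
says that the form of R⁻¹ is at least ‖w‖²/‖R‖. -/
theorem norm_apply_sq_le_norm_mul_inner (hR : 0 ≤ R) (g : H) :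
    ‖R g‖ ^ 2 ≤ ‖R‖ * (inner ℂ (R g) g).re := by
  obtain ⟨P, hP, hPR, -⟩ := exists_sqrt hR
  rw [re_inner_eq_norm_sq_of_sqrt hP hPR]
  have h1 : ‖R‖ = ‖P‖ ^ 2 := by
    rw [← hPR, sq, ← CStarRing.norm_star_mul_self (x := P), hP.star_eq]
  have h2 : ‖R g‖ ≤ ‖P‖ * ‖P g‖ := by
    rw [← hPR, mul_apply_eq_comp]
    exact P.le_opNorm _
  calc ‖R g‖ ^ 2 ≤ (‖P‖ * ‖P g‖) ^ 2 := by gcongr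
    _ = ‖R‖ * ‖P g‖ ^ 2 := by rw [h1]; ring

/-- The form is ‖R^(1/2)g‖² and R^(1/2) commutes with the semigroup, so the operator norm bound
holds in the form norm with the same rate. -/
theorem re_inner_heatSemigroup_le (hR : 0 ≤ R) {ρ : ℝ} (hρ : ‖R‖ ≤ ρ) (t : ℝ≥0) (g : H) :
    (inner ℂ (R (heatSemigroup R t g)) (heatSemigroup R t g)).re ≤
      Real.exp (-(t / ρ)) ^ 2 * (inner ℂ (R g) g).re := by
  obtain ⟨P, hP, hPR, hcomm⟩ := exists_sqrt hR
  rw [re_inner_eq_norm_sq_of_sqrt hP hPR, re_inner_eq_norm_sq_of_sqrt hP hPR, ← mul_pow]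
  have h1 : P (heatSemigroup R t g) = heatSemigroup R t (P g) :=
    (congrArg (fun A : H →L[ℂ] H => A g) (hcomm t).eq).symm
  rw [h1]
  gcongr
  exact (heatSemigroup R t).le_of_opNorm_le (norm_heatSemigroup_le hρ t) _

/-- The norm of a nonzero compact positive operator is an eigenvalue. -/
theorem exists_eigenvector_norm (hR : 0 ≤ R) (hc : IsCompactOperator R) (hne : R ≠ 0) :
    ∃ W, W ≠ 0 ∧ R W = ((‖R‖ : ℝ) : ℂ) • W := by
  have : Nontrivial (H →L[ℂ] H) := ⟨⟨R, 0, hne⟩⟩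
  have h1 : ‖R‖ ∈ spectrum ℝ R := CStarAlgebra.norm_mem_spectrum_of_nonneg hR
  have h2 : ((‖R‖ : ℝ) : ℂ) ∈ spectrum ℂ R := spectrum.algebraMap_mem ℂ h1
  have h3 : ((‖R‖ : ℝ) : ℂ) ≠ 0 := by simpa using hne
  obtain ⟨W, hW⟩ := ((hc.hasEigenvalue_iff_mem_spectrum h3).2 h2).exists_hasEigenvector
  exact ⟨W, hW.2, hW.apply_eq_smul⟩

end SquareRoot

/-! ### From a bound on the form to growth in the form norm -/

section FormBound

variable {H : Type*} [NormedAddCommGroup H] [InnerProductSpace ℂ H] [CompleteSpace H]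
  {N V : H →L[ℂ] H}

/-- Coercivity gives δ‖Rg‖² ≤ ⟨Rg, g⟩ ≤ ‖Rg‖‖g‖, and one factor ‖Rg‖ cancels. -/
theorem norm_perturbedResolvent_le (hN : IsSelfAdjoint N) (hNV : ‖V‖ * ‖N‖ ^ 2 ≤ 1 / 2)
    {δ : ℝ} (hδ : 0 < δ)
    (h : ∀ h, δ * ‖N (N h)‖ ^ 2 ≤ ‖N h‖ ^ 2 - (inner ℂ (N (N h)) (V (N (N h)))).re) :
    ‖perturbedResolvent N V‖ ≤ δ⁻¹ := by
  refine ContinuousLinearMap.opNorm_le_bound _ (by positivity) fun g => ?_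
  obtain ⟨x, rfl⟩ := exists_sub_perturbation_eq hNV g
  have h1 := h x
  rw [← inner_perturbedResolvent_eq (V := V) hN hNV x] at h1
  set g := x - V (N (N x))
  have h2 : perturbedResolvent N V g = N (N x) := perturbedResolvent_apply_sub hNV x
  rw [← h2] at h1
  have h3 : (inner ℂ (perturbedResolvent N V g) g).re ≤ ‖perturbedResolvent N V g‖ * ‖g‖ :=
    (Complex.re_le_norm _).trans (norm_inner_le_norm _ _)
  rcases (norm_nonneg (perturbedResolvent N V g)).eq_or_lt with h0 | h0
  · rw [← h0]; positivity
  · have h4 : δ * ‖perturbedResolvent N V g‖ ≤ ‖g‖ := by nlinarith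
    rw [inv_mul_eq_div, le_div_iff₀ hδ]
    linarith

/-- An operator that preserves the range of `N²` with a bound in the graph norm of `N⁻¹` preserves
the range of `N`, with the same bound. -/
theorem exists_apply_eq_of_denseRange (hd : DenseRange N) (hinj : Function.Injective N)
    {B : H →L[ℂ] H} {C : ℝ} (hC : 0 ≤ C)
    (key : ∀ x, ∃ y, B (N (N x)) = N (N y) ∧ ‖N y‖ ≤ C * ‖N x‖) (v : H) :
    ∃ v', B (N v) = N v' ∧ ‖v'‖ ≤ C * ‖v‖ := by
  choose y hy hyn using key
  -- The choice of y is made without linearity, but injectivity cancels one N in N²y(a - b) =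
  -- N²(y(a) - y(b)), so Ny is a Lipschitz function of Nx.
  have hsub : ∀ a b, ‖N (y a) - N (y b)‖ ≤ C * ‖N a - N b‖ := fun a b => by
    have h1 : N (N (y (a - b))) = N (N (y a - y b)) := by
      rw [← hy, map_sub, map_sub, map_sub, hy, hy, ← map_sub, ← map_sub]
    have h2 := hyn (a - b)
    rwa [hinj h1, map_sub, map_sub] at h2
  obtain ⟨u, hu, hlim⟩ := mem_closure_iff_seq_limit.1 (hd v)
  choose x hx using hu
  have hlim' : Tendsto (fun n => N (x n)) atTop (𝓝 v) := by simpa [hx] using hlim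
  have hcau : CauchySeq fun n => N (y (x n)) := by
    have h1 := hlim'.cauchySeq
    rw [Metric.cauchySeq_iff'] at h1 ⊢
    intro ε hε
    -- C may vanish, hence the divisor C + 1.
    obtain ⟨n₀, hn₀⟩ := h1 (ε / (C + 1)) (by positivity)
    refine ⟨n₀, fun n hn => ?_⟩
    have h2 := hn₀ n hn
    rw [dist_eq_norm, lt_div_iff₀ (by positivity)] at h2
    rw [dist_eq_norm]
    exact (hsub _ _).trans_lt (by nlinarith [norm_nonneg (N (x n) - N (x n₀))])
  obtain ⟨v', hv'⟩ := cauchySeq_tendsto_of_complete hcau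
  refine ⟨v', ?_, ?_⟩
  · have h1 := ((B.continuous.comp N.continuous).tendsto v).comp hlim'
    have h2 := (N.continuous.tendsto v').comp hv'
    refine tendsto_nhds_unique h1 (h2.congr fun n => ?_)
    simp [hy]
  · exact le_of_tendsto_of_tendsto' hv'.norm (hlim'.norm.const_mul C) fun n => hyn (x n)

/-- The quadratic form of `κ - R⁻¹` is bounded by `λ`, hence its semigroup grows at most like
`exp (λ t)` in the form norm. -/
theorem exists_shiftedHeatSemigroup_apply_eq (hN : IsSelfAdjoint N) (hinj : Function.Injective N)
    (hV : IsSelfAdjoint V) (hNV : ‖V‖ * ‖N‖ ^ 2 ≤ 1 / 2) {κ lam : ℝ} (hlam : lam < κ)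
    (h : ∀ h, (κ - lam) * ‖N (N h)‖ ^ 2 ≤ ‖N h‖ ^ 2 - (inner ℂ (N (N h)) (V (N (N h)))).re)
    (t : ℝ≥0) (v : H) :
    ∃ v', shiftedHeatSemigroup (perturbedResolvent N V) κ t (N v) = N v' ∧
      ‖v'‖ ≤ 2 * Real.exp (lam * t) * ‖v‖ := by
  set R := perturbedResolvent N V with hRdef
  have hR : 0 ≤ R := perturbedResolvent_nonneg hN hV hNV
  have hρ : ‖R‖ ≤ (κ - lam)⁻¹ := norm_perturbedResolvent_le hN hNV (sub_pos.2 hlam) h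
  -- the bound on the dense range of `N`
  have key : ∀ x : H, ∃ y : H, heatSemigroup R t (N (N x)) = N (N y) ∧
      ‖N y‖ ≤ 2 * Real.exp (-(t * (κ - lam))) * ‖N x‖ := by
    intro x
    have hx := perturbedResolvent_apply_sub hNV x
    have hx2 := inner_perturbedResolvent_eq (V := V) hN hNV x
    set g := x - V (N (N x))
    obtain ⟨y, hy⟩ := exists_sub_perturbation_eq hNV (heatSemigroup R t g)
    have hy1 := perturbedResolvent_apply_sub hNV y
    have hy2 := inner_perturbedResolvent_eq (V := V) hN hNV y
    rw [hy] at hy1 hy2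
    refine ⟨y, ?_, ?_⟩
    · rw [← hx, ← hy1]
      exact heatSemigroup_apply_comm hR t g
    · have h1 := re_inner_heatSemigroup_le hR hρ t g
      rw [hy2, hx2, div_inv_eq_mul] at h1
      have h2 := abs_le.1 (abs_inner_perturbation_le hNV (N x))
      have h3 := abs_le.1 (abs_inner_perturbation_le hNV (N y))
      set E := Real.exp (-(t * (κ - lam)))
      refine le_of_sq_le_sq ?_ (by positivity)
      -- The chain is ‖Ny‖²/2 ≤ form(y) ≤ E² form(x) ≤ (3/2)E²‖Nx‖². Hence ‖Ny‖ ≤ √3 E‖Nx‖, and √3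
      -- is rounded up to 2.
      have h4 : E ^ 2 * (‖N x‖ ^ 2 - (inner ℂ (N (N x)) (V (N (N x)))).re) ≤
          E ^ 2 * (3 / 2 * ‖N x‖ ^ 2) := by
        gcongr
        linarith
      have h5 : 0 ≤ E ^ 2 * ‖N x‖ ^ 2 := by positivity
      nlinarith
  -- extension to all `v`
  have hext : ∃ v', heatSemigroup R t (N v) = N v' ∧
      ‖v'‖ ≤ 2 * Real.exp (-(t * (κ - lam))) * ‖v‖ :=
    exists_apply_eq_of_denseRange (denseRange_of_isSelfAdjoint hN hinj) hinj
      (by positivity) key v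
  obtain ⟨v', h1, h2⟩ := hext
  refine ⟨((Real.exp (κ * t) : ℝ) : ℂ) • v', ?_, ?_⟩
  · rw [shiftedHeatSemigroup, _root_.smul_apply, h1, map_smul]
  · rw [norm_smul, Complex.norm_real, Real.norm_of_nonneg (Real.exp_nonneg _)]
    calc Real.exp (κ * t) * ‖v'‖ ≤
          Real.exp (κ * t) * (2 * Real.exp (-(t * (κ - lam))) * ‖v‖) := by gcongr
      _ = 2 * (Real.exp (κ * t) * Real.exp (-(t * (κ - lam)))) * ‖v‖ := by ring
      _ = 2 * Real.exp (lam * t) * ‖v‖ := by rw [← Real.exp_add]; ring_nf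

end FormBound

end SwiftHohenberg

namespace SwiftHohenberg

open scoped BoundedContinuousFunction ComplexConjugate FourierTransform

/-! ### Multiplication operators on `L²` -/

section MulOp

variable {α : Type*} [TopologicalSpace α] [MeasurableSpace α] [OpensMeasurableSpace α]
  [SecondCountableTopology α] {μ : Measure α}

theorem memLp_bounded_mul (f : α →ᵇ ℂ) (g : Lp ℂ 2 μ) : MemLp (fun x => f x * g x) 2 μ :=
  MemLp.of_le_mul (c := ‖f‖) (Lp.memLp g)
    (f.continuous.aestronglyMeasurable.mul (Lp.aestronglyMeasurable g))
    (Eventually.of_forall fun x => by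
      rw [norm_mul]; gcongr; exact f.norm_coe_le_norm x)

/-- Multiplication by a bounded continuous function, linear in both arguments. -/
def mulOp (μ : Measure α) : (α →ᵇ ℂ) →L[ℂ] Lp ℂ 2 μ →L[ℂ] Lp ℂ 2 μ :=
  LinearMap.mkContinuous₂
    (LinearMap.mk₂ ℂ (fun f g => (memLp_bounded_mul f g).toLp _)
      (fun f f' g => by
        rw [← MemLp.toLp_add]
        refine MemLp.toLp_congr _ _ (Eventually.of_forall fun x => ?_)
        simp [add_mul])
      (fun c f g => by
        rw [← MemLp.toLp_const_smul]
        refine MemLp.toLp_congr _ _ (Eventually.of_forall fun x => ?_)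
        simp [mul_assoc])
      (fun f g g' => by
        rw [← MemLp.toLp_add]
        refine MemLp.toLp_congr _ _ ?_
        filter_upwards [Lp.coeFn_add g g'] with x hx
        simp only [Pi.add_apply] at hx ⊢
        rw [hx, mul_add])
      (fun c f g => by
        rw [← MemLp.toLp_const_smul]
        refine MemLp.toLp_congr _ _ ?_
        filter_upwards [Lp.coeFn_smul c g] with x hx
        simp [hx, mul_left_comm]))
    1 (fun f g => by
      rw [one_mul]
      refine Lp.norm_le_mul_norm_of_ae_le_mul ?_
      filter_upwards [MemLp.coeFn_toLp (memLp_bounded_mul f g)] with x hx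
      simp only [LinearMap.mk₂_apply]
      rw [hx, norm_mul]
      gcongr
      exact f.norm_coe_le_norm x)

theorem coeFn_mulOp (f : α →ᵇ ℂ) (g : Lp ℂ 2 μ) : mulOp μ f g =ᵐ[μ] fun x => f x * g x :=
  MemLp.coeFn_toLp (memLp_bounded_mul f g)

theorem norm_mulOp_le_of_forall {f : α →ᵇ ℂ} {C : ℝ} (hC : 0 ≤ C) (hf : ∀ x, ‖f x‖ ≤ C) :
    ‖mulOp μ f‖ ≤ C := by
  refine ContinuousLinearMap.opNorm_le_bound _ hC fun g => ?_
  refine Lp.norm_le_mul_norm_of_ae_le_mul ?_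
  filter_upwards [coeFn_mulOp f g] with x hx
  rw [hx, norm_mul]
  gcongr
  exact hf x

theorem mulOp_mul (f f' : α →ᵇ ℂ) : mulOp μ (f * f') = mulOp μ f * mulOp μ f' := by
  ext1 g
  refine Lp.ext ?_
  rw [mul_apply_eq_comp]
  filter_upwards [coeFn_mulOp (f * f') g, coeFn_mulOp f (mulOp μ f' g), coeFn_mulOp f' g]
    with x h1 h2 h3
  rw [h1, h2, h3, BoundedContinuousFunction.mul_apply, mul_assoc]

theorem mulOp_one : mulOp μ (1 : α →ᵇ ℂ) = 1 := by
  ext1 g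
  refine Lp.ext ?_
  filter_upwards [coeFn_mulOp 1 g] with x h1
  rw [h1]
  simp

theorem isSelfAdjoint_mulOp {f : α →ᵇ ℂ} (hf : ∀ x, conj (f x) = f x) :
    IsSelfAdjoint (mulOp μ f) := by
  rw [ContinuousLinearMap.isSelfAdjoint_iff_isSymmetric]
  intro g g'
  rw [ContinuousLinearMap.coe_coe, L2.inner_def, L2.inner_def]
  refine integral_congr_ae ?_
  filter_upwards [coeFn_mulOp f g, coeFn_mulOp f g'] with x h1 h2
  rw [h1, h2]
  simp only [RCLike.inner_apply, map_mul, hf]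
  ring

theorem injective_mulOp {f : α →ᵇ ℂ} (hf : ∀ x, f x ≠ 0) : Function.Injective (mulOp μ f) := by
  intro g g' h
  refine Lp.ext ?_
  filter_upwards [coeFn_mulOp f g, coeFn_mulOp f g'] with x h1 h2
  rw [← h] at h2
  exact mul_left_cancel₀ (hf x) (h1.symm.trans h2)

end MulOp

/-! ### Fourier multipliers on `L²(ℝ²)` -/

section FourierMul

/-- The Fourier multiplier on `L²(ℝ²)` with a bounded continuous symbol. -/
def fourierMul (f : Plane →ᵇ ℂ) : L2Plane →L[ℂ] L2Plane :=
  ((Lp.fourierTransformₗᵢ Plane ℂ).symm.toContinuousLinearEquiv : L2Plane →L[ℂ] L2Plane) ∘L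
    mulOp volume f ∘L
    ((Lp.fourierTransformₗᵢ Plane ℂ).toContinuousLinearEquiv : L2Plane →L[ℂ] L2Plane)

theorem fourierMul_apply (f : Plane →ᵇ ℂ) (g : L2Plane) :
    fourierMul f g = 𝓕⁻ (mulOp volume f (𝓕 g)) := rfl

theorem fourier_fourierMul (f : Plane →ᵇ ℂ) (g : L2Plane) :
    𝓕 (fourierMul f g) = mulOp volume f (𝓕 g) := by
  rw [fourierMul_apply, FourierTransform.fourier_fourierInv_eq]

theorem injective_fourier_L2 : Function.Injective fun g : L2Plane => 𝓕 g :=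
  (Lp.fourierTransformₗᵢ Plane ℂ).injective

theorem norm_fourierMul_le_of_forall {f : Plane →ᵇ ℂ} {C : ℝ} (hC : 0 ≤ C)
    (hf : ∀ x, ‖f x‖ ≤ C) : ‖fourierMul f‖ ≤ C := by
  refine ContinuousLinearMap.opNorm_le_bound _ hC fun g => ?_
  rw [← Lp.norm_fourier_eq, fourier_fourierMul, ← Lp.norm_fourier_eq g]
  exact (mulOp volume f).le_of_opNorm_le (norm_mulOp_le_of_forall hC hf) _

theorem fourierMul_mul (f f' : Plane →ᵇ ℂ) :
    fourierMul (f * f') = fourierMul f * fourierMul f' := by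
  ext1 g
  apply injective_fourier_L2
  simp only [mul_apply_eq_comp, fourier_fourierMul, mulOp_mul]

theorem fourierMul_mul_apply (f f' : Plane →ᵇ ℂ) (g : L2Plane) :
    fourierMul (f * f') g = fourierMul f (fourierMul f' g) := by
  rw [fourierMul_mul, mul_apply_eq_comp]

theorem fourierMul_one : fourierMul 1 = 1 := by
  ext1 g
  apply injective_fourier_L2
  simp only [fourier_fourierMul, mulOp_one, one_apply_eq_self]

theorem fourierMul_sub_apply (f f' : Plane →ᵇ ℂ) (g : L2Plane) :
    fourierMul (f - f') g = fourierMul f g - fourierMul f' g := by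
  simp only [fourierMul, map_sub, ContinuousLinearMap.coe_comp, Function.comp_apply,
    _root_.sub_apply]

theorem fourierMul_smul_apply (c : ℂ) (f : Plane →ᵇ ℂ) (g : L2Plane) :
    fourierMul (c • f) g = c • fourierMul f g := by
  simp only [fourierMul, map_smul, ContinuousLinearMap.coe_comp, Function.comp_apply,
    _root_.smul_apply]

theorem isSelfAdjoint_fourierMul {f : Plane →ᵇ ℂ} (hf : ∀ x, conj (f x) = f x) :
    IsSelfAdjoint (fourierMul f) := by
  rw [ContinuousLinearMap.isSelfAdjoint_iff_isSymmetric]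
  intro g g'
  rw [ContinuousLinearMap.coe_coe, ← Lp.inner_fourier_eq, ← Lp.inner_fourier_eq g,
    fourier_fourierMul, fourier_fourierMul]
  exact inner_apply_comm_of_isSelfAdjoint (isSelfAdjoint_mulOp hf) _ _

theorem injective_fourierMul {f : Plane →ᵇ ℂ} (hf : ∀ x, f x ≠ 0) :
    Function.Injective (fourierMul f) := by
  intro g g' h
  apply injective_fourier_L2
  apply injective_mulOp (μ := volume) hf
  rw [← fourier_fourierMul, ← fourier_fourierMul, h]

theorem injective_toTemperedDistribution {f g : L2Plane}
    (h : (f : 𝓢'(Plane, ℂ)) = (g : 𝓢'(Plane, ℂ))) : f = g := by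
  have := LinearMap.ker_eq_bot.1 (Lp.ker_toTemperedDistributionCLM_eq_bot (F := ℂ)
    (μ := (volume : Measure Plane)) (p := 2))
  exact this h

theorem toTemperedDistribution_mulOp {f : Plane →ᵇ ℂ} (hf : Function.HasTemperateGrowth f)
    (g : L2Plane) :
    ((mulOp volume f g : L2Plane) : 𝓢'(Plane, ℂ)) =
      TemperedDistribution.smulLeftCLM ℂ f (g : 𝓢'(Plane, ℂ)) := by
  ext u
  simp only [Lp.toTemperedDistribution_apply, TemperedDistribution.smulLeftCLM_apply_apply]
  refine integral_congr_ae ?_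
  filter_upwards [coeFn_mulOp f g] with x hx
  rw [hx, SchwartzMap.smulLeftCLM_apply_apply hf]
  simp only [smul_eq_mul]
  ring

/-- This is the bridge between bounded multipliers on L² and multipliers on tempered distributions;
unbounded symbols such as that of A² live only on the latter side. -/
theorem toTemperedDistribution_fourierMul {f : Plane →ᵇ ℂ} (hf : Function.HasTemperateGrowth f)
    (g : L2Plane) :
    ((fourierMul f g : L2Plane) : 𝓢'(Plane, ℂ)) =
      TemperedDistribution.fourierMultiplierCLM ℂ f (g : 𝓢'(Plane, ℂ)) := by
  rw [fourierMul_apply, TemperedDistribution.fourierMultiplierCLM_apply,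
    Lp.fourier_toTemperedDistribution_eq, ← toTemperedDistribution_mulOp hf,
    Lp.fourierInv_toTemperedDistribution_eq]

end FourierMul

end SwiftHohenberg

namespace SwiftHohenberg

open scoped BoundedContinuousFunction ComplexConjugate FourierTransform
open TemperedDistribution (fourierMultiplierCLM fourierMultiplierCLM_apply smulLeftCLM_add
  smulLeftCLM_smul fourierMultiplierCLM_fourierMultiplierCLM_apply besselPotential
  fourierMultiplierCLM_const)

/-! ### The linearized operator on the plane -/

/-- The Fourier symbol of `1 + (1 + 2εω)∂ₓ² + ∂_y²`. -/
def planeSymbol (ε ω : ℝ) (ξ : Plane) : ℝ :=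
  1 - (1 + 2 * ε * ω) * (2 * Real.pi * ξ 0) ^ 2 - (2 * Real.pi * ξ 1) ^ 2

theorem inner_single_one (ξ : Plane) (i : Fin 2) :
    inner ℝ ξ (EuclideanSpace.single i (1 : ℝ)) = ξ i := by
  simp [EuclideanSpace.inner_single_right]

theorem hasTemperateGrowth_coord (i : Fin 2) :
    Function.HasTemperateGrowth fun ξ : Plane => ξ i := by
  have : Function.HasTemperateGrowth
      fun ξ : Plane => inner ℝ ξ (EuclideanSpace.single i (1 : ℝ)) := by fun_prop
  simpa only [inner_single_one] using this

theorem hasTemperateGrowth_planeSymbol (ε ω : ℝ) :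
    Function.HasTemperateGrowth fun ξ : Plane => (planeSymbol ε ω ξ : ℂ) := by
  have h0 := hasTemperateGrowth_coord 0
  have h1 := hasTemperateGrowth_coord 1
  unfold planeSymbol
  fun_prop

theorem fourierMultiplierCLM_add' {g₁ g₂ : Plane → ℂ} (h₁ : Function.HasTemperateGrowth g₁)
    (h₂ : Function.HasTemperateGrowth g₂) (f : 𝓢'(Plane, ℂ)) :
    fourierMultiplierCLM ℂ (g₁ + g₂) f =
      fourierMultiplierCLM ℂ g₁ f + fourierMultiplierCLM ℂ g₂ f := by
  simp only [fourierMultiplierCLM_apply, smulLeftCLM_add h₁ h₂, _root_.add_apply,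
    FourierTransform.fourierInv_add]

theorem lineDeriv_lineDeriv_eq (i : Fin 2) (f : 𝓢'(Plane, ℂ)) :
    ∂_{EuclideanSpace.single i (1 : ℝ)} (∂_{EuclideanSpace.single i (1 : ℝ)} f) =
      fourierMultiplierCLM ℂ (fun ξ : Plane => ((-(2 * Real.pi * ξ i) ^ 2 : ℝ) : ℂ)) f := by
  have h0 : Function.HasTemperateGrowth fun ξ : Plane => ((ξ i : ℝ) : ℂ) := by
    have := hasTemperateGrowth_coord i
    fun_prop
  have key : ∀ f : 𝓢'(Plane, ℂ), ∂_{EuclideanSpace.single i (1 : ℝ)} f =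
      fourierMultiplierCLM ℂ ((2 * Real.pi * Complex.I : ℂ) • fun ξ : Plane => ((ξ i : ℝ) : ℂ)) f
      := fun f => by
    rw [TemperedDistribution.lineDeriv_eq_fourierMultiplierCLM,
      TemperedDistribution.fourierMultiplierCLM_smul h0]
    simp only [inner_single_one]
    rfl
  have h1 : Function.HasTemperateGrowth
      ((2 * Real.pi * Complex.I : ℂ) • fun ξ : Plane => ((ξ i : ℝ) : ℂ)) := by
    change Function.HasTemperateGrowth fun ξ : Plane =>
      (2 * Real.pi * Complex.I : ℂ) • ((ξ i : ℝ) : ℂ)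
    fun_prop
  rw [key, key, fourierMultiplierCLM_fourierMultiplierCLM_apply h1 h1]
  congr 2
  ext ξ
  simp only [Pi.mul_apply, Pi.smul_apply, smul_eq_mul]
  push_cast
  linear_combination (2 * Real.pi * ξ i : ℂ) ^ 2 * Complex.I_sq

theorem opA_eq_fourierMultiplierCLM (ε ω : ℝ) (f : 𝓢'(Plane, ℂ)) :
    opA ε ω f = fourierMultiplierCLM ℂ (fun ξ => (planeSymbol ε ω ξ : ℂ)) f := by
  have h0 := hasTemperateGrowth_coord 0
  have h1 := hasTemperateGrowth_coord 1
  have hA : Function.HasTemperateGrowth fun ξ : Plane => ((-(2 * Real.pi * ξ 0) ^ 2 : ℝ) : ℂ) := by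
    fun_prop
  have hB : Function.HasTemperateGrowth fun ξ : Plane => ((-(2 * Real.pi * ξ 1) ^ 2 : ℝ) : ℂ) := by
    fun_prop
  have hA' : Function.HasTemperateGrowth (((1 + 2 * ε * ω : ℝ) : ℂ) •
      fun ξ : Plane => ((-(2 * Real.pi * ξ 0) ^ 2 : ℝ) : ℂ)) := by
    change Function.HasTemperateGrowth fun ξ : Plane => ((1 + 2 * ε * ω : ℝ) : ℂ) •
      ((-(2 * Real.pi * ξ 0) ^ 2 : ℝ) : ℂ)
    fun_prop
  have hone : Function.HasTemperateGrowth fun _ : Plane => (1 : ℂ) := by fun_prop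
  have hC : f = fourierMultiplierCLM ℂ (fun _ : Plane => (1 : ℂ)) f := by simp
  have hsum : (fun ξ => (planeSymbol ε ω ξ : ℂ)) = ((fun _ : Plane => (1 : ℂ)) +
      (((1 + 2 * ε * ω : ℝ) : ℂ) • fun ξ : Plane => ((-(2 * Real.pi * ξ 0) ^ 2 : ℝ) : ℂ))) +
      fun ξ : Plane => ((-(2 * Real.pi * ξ 1) ^ 2 : ℝ) : ℂ) := by
    ext ξ
    simp only [planeSymbol, Pi.add_apply, Pi.smul_apply, smul_eq_mul]
    push_cast
    ring
  rw [hsum, fourierMultiplierCLM_add' (hone.add hA') hB, fourierMultiplierCLM_add' hone hA',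
    ← hC, TemperedDistribution.fourierMultiplierCLM_smul hA, opA, lineDeriv_lineDeriv_eq,
    lineDeriv_lineDeriv_eq]
  rfl

theorem opA_opA_eq_fourierMultiplierCLM (ε ω : ℝ) (f : 𝓢'(Plane, ℂ)) :
    opA ε ω (opA ε ω f) =
      fourierMultiplierCLM ℂ (fun ξ => ((planeSymbol ε ω ξ ^ 2 : ℝ) : ℂ)) f := by
  rw [opA_eq_fourierMultiplierCLM, opA_eq_fourierMultiplierCLM,
    fourierMultiplierCLM_fourierMultiplierCLM_apply (hasTemperateGrowth_planeSymbol ε ω)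
      (hasTemperateGrowth_planeSymbol ε ω)]
  congr 2
  ext ξ
  simp [sq]

/-! #### Bounds on the symbol -/

section Symbol

variable {ε ω : ℝ}

theorem norm_sq_eq_coords (ξ : Plane) : ‖ξ‖ ^ 2 = ξ 0 ^ 2 + ξ 1 ^ 2 := by
  rw [EuclideanSpace.norm_sq_eq]
  simp [Fin.sum_univ_two]

theorem exists_abs_planeSymbol_le (hk : 0 < 1 + 2 * ε * ω) :
    ∃ C : ℝ, 0 < C ∧ ∀ ξ : Plane, |planeSymbol ε ω ξ| ≤ C * (1 + ‖ξ‖ ^ 2) := by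
  refine ⟨1 + (1 + (1 + 2 * ε * ω)) * (2 * Real.pi) ^ 2, by positivity, fun ξ => ?_⟩
  rw [norm_sq_eq_coords, planeSymbol]
  set k := 1 + 2 * ε * ω
  set P := (2 * Real.pi) ^ 2 with hP
  have hP0 : 0 < P := by positivity
  have e0 : (2 * Real.pi * ξ 0) ^ 2 = P * ξ 0 ^ 2 := by rw [hP]; ring
  have e1 : (2 * Real.pi * ξ 1) ^ 2 = P * ξ 1 ^ 2 := by rw [hP]; ring
  rw [e0, e1, abs_le]
  have a0 := mul_nonneg hP0.le (sq_nonneg (ξ 0))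
  have a1 := mul_nonneg hP0.le (sq_nonneg (ξ 1))
  have b0 := mul_nonneg hk.le a0
  have b1 := mul_nonneg hk.le a1
  have c := mul_pos hk hP0
  constructor <;> nlinarith [sq_nonneg (ξ 0), sq_nonneg (ξ 1)]

/-- Ellipticity: 1 minus the symbol is a quadratic form in ξ, positive definite because 1 + 2εω > 0,
and at least min(1 + 2εω, 1)(2π)²‖ξ‖². -/
theorem exists_one_add_norm_sq_le (hk : 0 < 1 + 2 * ε * ω) :
    ∃ C : ℝ, 0 < C ∧ ∀ ξ : Plane, 1 + ‖ξ‖ ^ 2 ≤ C * (1 + |planeSymbol ε ω ξ|) := by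
  set k := 1 + 2 * ε * ω with hkdef
  set P := (2 * Real.pi) ^ 2 with hP
  have hP0 : 0 < P := by positivity
  set c := min k 1 * P with hc
  have hc0 : 0 < c := by positivity
  refine ⟨1 + 1 / c, by positivity, fun ξ => ?_⟩
  have h1 : c * ‖ξ‖ ^ 2 ≤ 1 + |planeSymbol ε ω ξ| := by
    have h2 : c * ‖ξ‖ ^ 2 ≤ 1 - planeSymbol ε ω ξ := by
      rw [norm_sq_eq_coords, planeSymbol, ← hkdef]
      have e0 : (2 * Real.pi * ξ 0) ^ 2 = P * ξ 0 ^ 2 := by rw [hP]; ring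
      have e1 : (2 * Real.pi * ξ 1) ^ 2 = P * ξ 1 ^ 2 := by rw [hP]; ring
      rw [e0, e1, hc]
      have a0 := mul_nonneg hP0.le (sq_nonneg (ξ 0))
      have a1 := mul_nonneg hP0.le (sq_nonneg (ξ 1))
      nlinarith [mul_le_mul_of_nonneg_right (min_le_left k 1) a0,
        mul_le_mul_of_nonneg_right (min_le_right k 1) a1]
    linarith [neg_abs_le (planeSymbol ε ω ξ)]
  have h3 : ‖ξ‖ ^ 2 ≤ 1 / c * (1 + |planeSymbol ε ω ξ|) := by
    rw [one_div, ← div_eq_inv_mul, le_div_iff₀ hc0]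
    linarith
  nlinarith [abs_nonneg (planeSymbol ε ω ξ)]

theorem continuous_planeSymbol : Continuous (planeSymbol ε ω) := by
  unfold planeSymbol
  fun_prop

/-- `√(a² + κ)`, where `a` is the symbol of `1 + (1 + 2εω)∂ₓ² + ∂_y²`. -/
def formSymbol (ε ω κ : ℝ) (ξ : Plane) : ℝ := √(planeSymbol ε ω ξ ^ 2 + κ)

variable {κ : ℝ}

theorem continuous_formSymbol : Continuous (formSymbol ε ω κ) := by
  have := continuous_planeSymbol (ε := ε) (ω := ω)
  unfold formSymbol
  fun_prop

theorem formSymbol_sq (hκ : 1 ≤ κ) (ξ : Plane) :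
    formSymbol ε ω κ ξ ^ 2 = planeSymbol ε ω ξ ^ 2 + κ :=
  Real.sq_sqrt (by positivity)

theorem one_le_formSymbol (hκ : 1 ≤ κ) (ξ : Plane) : 1 ≤ formSymbol ε ω κ ξ :=
  Real.one_le_sqrt.2 (by nlinarith [sq_nonneg (planeSymbol ε ω ξ)])

theorem formSymbol_pos (hκ : 1 ≤ κ) (ξ : Plane) : 0 < formSymbol ε ω κ ξ :=
  one_pos.trans_le (one_le_formSymbol hκ ξ)

theorem sqrt_le_formSymbol (ξ : Plane) : √κ ≤ formSymbol ε ω κ ξ :=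
  Real.sqrt_le_sqrt (by nlinarith [sq_nonneg (planeSymbol ε ω ξ)])

theorem abs_planeSymbol_le_formSymbol (hκ : 1 ≤ κ) (ξ : Plane) :
    |planeSymbol ε ω ξ| ≤ formSymbol ε ω κ ξ :=
  Real.abs_le_sqrt (by linarith)

theorem exists_formSymbol_le (hk : 0 < 1 + 2 * ε * ω) (hκ : 1 ≤ κ) :
    ∃ C : ℝ, 0 < C ∧ ∀ ξ : Plane, formSymbol ε ω κ ξ ≤ C * (1 + ‖ξ‖ ^ 2) := by
  obtain ⟨C, hC, h⟩ := exists_abs_planeSymbol_le hk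
  -- With p = 1 + ‖ξ‖² ≥ 1 and κ ≥ 1, both a² ≤ (Cp)² and κ ≤ (κp)² hold, so a² + κ ≤ ((C + κ)p)².
  refine ⟨C + κ, by positivity, fun ξ => ?_⟩
  refine Real.sqrt_le_iff.2 ⟨by positivity, ?_⟩
  have h1 : planeSymbol ε ω ξ ^ 2 ≤ (C * (1 + ‖ξ‖ ^ 2)) ^ 2 := by
    rw [← sq_abs]; gcongr; exact h ξ
  have h2 : 1 ≤ 1 + ‖ξ‖ ^ 2 := by nlinarith [sq_nonneg ‖ξ‖]
  set p := 1 + ‖ξ‖ ^ 2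
  have h3 : κ ≤ (κ * p) ^ 2 := by nlinarith [mul_le_mul hκ h2 zero_le_one (by linarith)]
  nlinarith [mul_pos (mul_pos hC (by linarith : 0 < p))
    (mul_pos (by linarith : 0 < κ) (by linarith : 0 < p))]

theorem exists_one_add_norm_sq_le_formSymbol (hk : 0 < 1 + 2 * ε * ω) (hκ : 1 ≤ κ) :
    ∃ C : ℝ, 0 < C ∧ ∀ ξ : Plane, 1 + ‖ξ‖ ^ 2 ≤ C * formSymbol ε ω κ ξ := by
  obtain ⟨C, hC, h⟩ := exists_one_add_norm_sq_le hk
  refine ⟨C * 2, by positivity, fun ξ => (h ξ).trans ?_⟩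
  rw [mul_assoc]
  gcongr
  linarith [one_le_formSymbol (ε := ε) (ω := ω) hκ ξ,
    abs_planeSymbol_le_formSymbol (ε := ε) (ω := ω) hκ ξ]

end Symbol

end SwiftHohenberg

namespace SwiftHohenberg

open scoped BoundedContinuousFunction ComplexConjugate FourierTransform
open TemperedDistribution (fourierMultiplierCLM fourierMultiplierCLM_apply smulLeftCLM_add
  smulLeftCLM_smul fourierMultiplierCLM_fourierMultiplierCLM_apply besselPotential
  fourierMultiplierCLM_const)

/-! ### Real symbols as bounded complex functions -/

section RealBCF

variable {α : Type*} [TopologicalSpace α]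

open Classical in
/-- A bounded continuous real function as a complex one (and `0` for other functions). -/
def realBCF (f : α → ℝ) : α →ᵇ ℂ :=
  if h : Continuous f ∧ ∃ C, ∀ x, |f x| ≤ C then
    BoundedContinuousFunction.ofNormedAddCommGroup (fun x => (f x : ℂ))
      (Complex.continuous_ofReal.comp h.1) h.2.choose
      (fun x => by rw [Complex.norm_real]; exact h.2.choose_spec x)
  else 0

theorem realBCF_apply {f : α → ℝ} (hf : Continuous f) {C : ℝ} (hC : ∀ x, |f x| ≤ C) (x : α) :
    realBCF f x = (f x : ℂ) := by
  rw [realBCF, dif_pos ⟨hf, C, hC⟩]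
  rfl

theorem coe_realBCF {f : α → ℝ} (hf : Continuous f) {C : ℝ} (hC : ∀ x, |f x| ≤ C) :
    ⇑(realBCF f) = fun x => (f x : ℂ) :=
  funext fun x => realBCF_apply hf hC x

theorem conj_realBCF (f : α → ℝ) (x : α) : conj (realBCF f x) = realBCF f x := by
  unfold realBCF
  split_ifs with h
  · exact Complex.conj_ofReal _
  · simp

end RealBCF

/-! #### Sobolev spaces as ranges of Fourier multipliers -/

section Sobolev

variable {p : ℝ}

theorem one_le_one_add_norm_sq (ξ : Plane) : 1 ≤ 1 + ‖ξ‖ ^ 2 := by nlinarith [sq_nonneg ‖ξ‖]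

/-- The symbol `(1 + |ξ|²)^(-p/2)`. -/
def besselSymbol (p : ℝ) (ξ : Plane) : ℝ := (1 + ‖ξ‖ ^ 2) ^ (-p / 2)

theorem continuous_besselSymbol : Continuous (besselSymbol p) := by
  unfold besselSymbol
  refine Continuous.rpow_const (by fun_prop) fun ξ => Or.inl ?_
  linarith [one_le_one_add_norm_sq ξ]

theorem abs_besselSymbol_le (hp : 0 ≤ p) (ξ : Plane) : |besselSymbol p ξ| ≤ 1 := by
  have h := one_le_one_add_norm_sq ξ
  rw [besselSymbol, abs_of_nonneg (Real.rpow_nonneg (by linarith) _)]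
  exact Real.rpow_le_one_of_one_le_of_nonpos h (by linarith)

theorem coe_realBCF_besselSymbol (hp : 0 ≤ p) :
    ⇑(realBCF (besselSymbol p)) = fun ξ => (((1 + ‖ξ‖ ^ 2) ^ (-p / 2) : ℝ) : ℂ) :=
  coe_realBCF continuous_besselSymbol (abs_besselSymbol_le hp)

theorem toTemperedDistribution_fourierMul_besselSymbol (hp : 0 ≤ p) (g : L2Plane) :
    ((fourierMul (realBCF (besselSymbol p)) g : L2Plane) : 𝓢'(Plane, ℂ)) =
      besselPotential Plane ℂ (-p) (g : 𝓢'(Plane, ℂ)) := by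
  rw [toTemperedDistribution_fourierMul, coe_realBCF_besselSymbol hp, besselPotential]
  rw [coe_realBCF_besselSymbol hp]
  fun_prop

/-- For p ≥ 0 the inverse Bessel potential has a bounded symbol, so it acts on L² and the equation
can be solved for w there. Sobolev spaces become ranges of bounded multipliers. -/
theorem besselPotential_eq_iff (hp : 0 ≤ p) {w g : L2Plane} :
    besselPotential Plane ℂ p (w : 𝓢'(Plane, ℂ)) = (g : 𝓢'(Plane, ℂ)) ↔
      w = fourierMul (realBCF (besselSymbol p)) g := by
  rw [← TemperedDistribution.besselPotential_neg_apply_eq_iff,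
    ← toTemperedDistribution_fourierMul_besselSymbol hp]
  exact ⟨fun h => (injective_toTemperedDistribution h).symm, fun h => by rw [h]⟩

theorem memH_iff (hp : 0 ≤ p) {w : L2Plane} :
    MemH p w ↔ ∃ g : L2Plane, w = fourierMul (realBCF (besselSymbol p)) g :=
  exists_congr fun _ => besselPotential_eq_iff hp

theorem memH_fourierMul (hp : 0 ≤ p) (g : L2Plane) :
    MemH p (fourierMul (realBCF (besselSymbol p)) g) :=
  (memH_iff hp).2 ⟨g, rfl⟩

theorem besselSymbol_pos (ξ : Plane) : 0 < besselSymbol p ξ :=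
  Real.rpow_pos_of_pos (by linarith [one_le_one_add_norm_sq ξ]) _

/-- The representative chosen in `normH` is forced to be g, because the symbol never vanishes and
the multiplier is injective. -/
theorem normH_fourierMul (hp : 0 ≤ p) (g : L2Plane) :
    normH p (fourierMul (realBCF (besselSymbol p)) g) = ‖g‖ := by
  have h := memH_fourierMul hp g
  rw [normH, dif_pos h]
  have h1 := (besselPotential_eq_iff hp).1 h.choose_spec
  have hinj : Function.Injective (fourierMul (realBCF (besselSymbol p))) :=
    injective_fourierMul fun ξ => by
      rw [realBCF_apply continuous_besselSymbol (abs_besselSymbol_le hp)]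
      exact_mod_cast (besselSymbol_pos ξ).ne'
  rw [← hinj h1]

end Sobolev

section Plane

variable {ε ω κ : ℝ}

theorem besselSymbol_two (ξ : Plane) : besselSymbol 2 ξ = (1 + ‖ξ‖ ^ 2)⁻¹ := by
  rw [besselSymbol, show (-2 / 2 : ℝ) = -1 by norm_num, Real.rpow_neg_one]

theorem besselSymbol_four (ξ : Plane) : besselSymbol 4 ξ = (1 + ‖ξ‖ ^ 2)⁻¹ ^ 2 := by
  rw [besselSymbol, show (-4 / 2 : ℝ) = -((2 : ℕ) : ℝ) by norm_num,
    Real.rpow_neg (by positivity), Real.rpow_natCast, inv_pow]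

theorem continuous_inv_formSymbol (hκ : 1 ≤ κ) : Continuous fun ξ => (formSymbol ε ω κ ξ)⁻¹ :=
  continuous_formSymbol.inv₀ fun ξ => (formSymbol_pos hκ ξ).ne'

theorem abs_inv_formSymbol_le (hκ : 1 ≤ κ) (ξ : Plane) : |(formSymbol ε ω κ ξ)⁻¹| ≤ (√κ)⁻¹ := by
  rw [abs_of_pos (inv_pos.2 (formSymbol_pos hκ ξ))]
  gcongr
  exact sqrt_le_formSymbol ξ

/-- The operator `((1 + (1 + 2εω)∂ₓ² + ∂_y²)² + κ)^(-1/2)` on `L²(ℝ²)`. -/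
def planeN (ε ω κ : ℝ) : L2Plane →L[ℂ] L2Plane :=
  fourierMul (realBCF fun ξ => (formSymbol ε ω κ ξ)⁻¹)

theorem isSelfAdjoint_planeN : IsSelfAdjoint (planeN ε ω κ) :=
  isSelfAdjoint_fourierMul (conj_realBCF _)

theorem injective_planeN (hκ : 1 ≤ κ) : Function.Injective (planeN ε ω κ) :=
  injective_fourierMul fun ξ => by
    rw [realBCF_apply (continuous_inv_formSymbol hκ) (abs_inv_formSymbol_le hκ)]
    exact_mod_cast (inv_pos.2 (formSymbol_pos hκ ξ)).ne'

theorem norm_planeN_sq_le (hκ : 1 ≤ κ) : ‖planeN ε ω κ‖ ^ 2 ≤ κ⁻¹ := by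
  have h : ‖planeN ε ω κ‖ ≤ (√κ)⁻¹ := norm_fourierMul_le_of_forall (by positivity) fun ξ => by
    rw [realBCF_apply (continuous_inv_formSymbol hκ) (abs_inv_formSymbol_le hκ),
      Complex.norm_real]
    exact abs_inv_formSymbol_le hκ ξ
  calc ‖planeN ε ω κ‖ ^ 2 ≤ (√κ)⁻¹ ^ 2 := by gcongr
    _ = κ⁻¹ := by rw [inv_pow, Real.sq_sqrt (by linarith)]

/-- The symbol `(1 + |ξ|²) / √(a² + κ)`, bounded above and below. -/
def ratioSymbol (ε ω κ : ℝ) (ξ : Plane) : ℝ := (1 + ‖ξ‖ ^ 2) * (formSymbol ε ω κ ξ)⁻¹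

/-- The symbol `√(a² + κ) / (1 + |ξ|²)`, bounded above and below. -/
def invRatioSymbol (ε ω κ : ℝ) (ξ : Plane) : ℝ := formSymbol ε ω κ ξ * (1 + ‖ξ‖ ^ 2)⁻¹

theorem realBCF_ratioSymbol_apply (hk : 0 < 1 + 2 * ε * ω) (hκ : 1 ≤ κ) (ξ : Plane) :
    realBCF (ratioSymbol ε ω κ) ξ = (ratioSymbol ε ω κ ξ : ℂ) := by
  obtain ⟨C, -, hC⟩ := exists_one_add_norm_sq_le_formSymbol hk hκ
  refine realBCF_apply ?_ (C := C) (fun ξ => ?_) ξ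
  · have := continuous_inv_formSymbol (ε := ε) (ω := ω) hκ
    unfold ratioSymbol
    fun_prop
  · have h1 := formSymbol_pos (ε := ε) (ω := ω) hκ ξ
    rw [ratioSymbol, abs_of_nonneg (by positivity), ← div_eq_mul_inv, div_le_iff₀ h1]
    exact hC ξ

theorem realBCF_invRatioSymbol_apply (hk : 0 < 1 + 2 * ε * ω) (hκ : 1 ≤ κ) (ξ : Plane) :
    realBCF (invRatioSymbol ε ω κ) ξ = (invRatioSymbol ε ω κ ξ : ℂ) := by
  obtain ⟨C, -, hC⟩ := exists_formSymbol_le hk hκ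
  refine realBCF_apply ?_ (C := C) (fun ξ => ?_) ξ
  · have h1 := continuous_formSymbol (ε := ε) (ω := ω) (κ := κ)
    have h2 : Continuous fun ξ : Plane => (1 + ‖ξ‖ ^ 2)⁻¹ :=
      Continuous.inv₀ (by fun_prop) fun ξ => by positivity
    exact h1.mul h2
  · have h1 := formSymbol_pos (ε := ε) (ω := ω) hκ ξ
    rw [invRatioSymbol, abs_of_nonneg (by positivity), ← div_eq_mul_inv,
      div_le_iff₀ (by positivity)]
    exact hC ξ

/-- Together with the converse factorization through `invRatioSymbol`, it shows that N and the
Bessel potential of order -2 have the same range: each is the other times a bounded multiplier. -/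
theorem realBCF_inv_formSymbol_eq (hk : 0 < 1 + 2 * ε * ω) (hκ : 1 ≤ κ) :
    (realBCF fun ξ => (formSymbol ε ω κ ξ)⁻¹) =
      realBCF (besselSymbol 2) * realBCF (ratioSymbol ε ω κ) := by
  ext ξ
  rw [BoundedContinuousFunction.mul_apply, realBCF_ratioSymbol_apply hk hκ,
    realBCF_apply (continuous_inv_formSymbol hκ) (abs_inv_formSymbol_le hκ),
    realBCF_apply continuous_besselSymbol (abs_besselSymbol_le zero_le_two),
    besselSymbol_two, ratioSymbol, ← Complex.ofReal_mul, inv_mul_cancel_left₀ (by positivity)]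

theorem realBCF_besselSymbol_two_eq (hk : 0 < 1 + 2 * ε * ω) (hκ : 1 ≤ κ) :
    realBCF (besselSymbol 2) =
      (realBCF fun ξ => (formSymbol ε ω κ ξ)⁻¹) * realBCF (invRatioSymbol ε ω κ) := by
  ext ξ
  rw [BoundedContinuousFunction.mul_apply, realBCF_invRatioSymbol_apply hk hκ,
    realBCF_apply (continuous_inv_formSymbol hκ) (abs_inv_formSymbol_le hκ),
    realBCF_apply continuous_besselSymbol (abs_besselSymbol_le zero_le_two),
    besselSymbol_two, invRatioSymbol, ← Complex.ofReal_mul,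
    inv_mul_cancel_left₀ (formSymbol_pos hκ ξ).ne']

theorem realBCF_besselSymbol_four_eq :
    realBCF (besselSymbol 4) = realBCF (besselSymbol 2) * realBCF (besselSymbol 2) := by
  ext ξ
  rw [BoundedContinuousFunction.mul_apply,
    realBCF_apply continuous_besselSymbol (abs_besselSymbol_le (by norm_num)),
    realBCF_apply continuous_besselSymbol (abs_besselSymbol_le zero_le_two),
    besselSymbol_two, besselSymbol_four, ← Complex.ofReal_mul, sq]

/-- The symbol `a² (1 + |ξ|²)⁻²` of the principal part applied to `H⁴(ℝ²)`. -/
def principalSymbol (ε ω : ℝ) (ξ : Plane) : ℝ := planeSymbol ε ω ξ ^ 2 * besselSymbol 4 ξ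

theorem coe_realBCF_principalSymbol (hk : 0 < 1 + 2 * ε * ω) :
    ⇑(realBCF (principalSymbol ε ω)) = fun ξ => (principalSymbol ε ω ξ : ℂ) := by
  obtain ⟨C, hC0, hC⟩ := exists_abs_planeSymbol_le hk
  refine coe_realBCF (C := C ^ 2)
    ((continuous_planeSymbol.pow 2).mul continuous_besselSymbol) fun ξ => ?_
  rw [principalSymbol, besselSymbol_four, ← mul_pow, abs_pow, abs_mul,
    abs_of_nonneg (a := (1 + ‖ξ‖ ^ 2)⁻¹) (by positivity), ← div_eq_mul_inv]
  gcongr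
  rw [div_le_iff₀ (by positivity)]
  exact hC ξ

theorem hasTemperateGrowth_besselSymbol (p : ℝ) :
    Function.HasTemperateGrowth fun ξ => ((besselSymbol p ξ : ℝ) : ℂ) := by
  unfold besselSymbol
  fun_prop

theorem hasTemperateGrowth_planeSymbol_sq :
    Function.HasTemperateGrowth fun ξ => ((planeSymbol ε ω ξ ^ 2 : ℝ) : ℂ) := by
  have := hasTemperateGrowth_planeSymbol ε ω
  have h : (fun ξ => ((planeSymbol ε ω ξ ^ 2 : ℝ) : ℂ)) =
      (fun ξ => (planeSymbol ε ω ξ : ℂ)) * fun ξ => (planeSymbol ε ω ξ : ℂ) := by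
    ext ξ
    simp [sq]
  rw [h]
  exact this.mul this

theorem toTemperedDistribution_principal (hk : 0 < 1 + 2 * ε * ω) (g : L2Plane) :
    opA ε ω (opA ε ω ((fourierMul (realBCF (besselSymbol 4)) g : L2Plane) : 𝓢'(Plane, ℂ))) =
      ((fourierMul (realBCF (principalSymbol ε ω)) g : L2Plane) : 𝓢'(Plane, ℂ)) := by
  have h4 : (0 : ℝ) ≤ 4 := by norm_num
  have hg4 := hasTemperateGrowth_besselSymbol 4
  have ha := hasTemperateGrowth_planeSymbol_sq (ε := ε) (ω := ω)
  have hprod : (fun ξ => (principalSymbol ε ω ξ : ℂ)) =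
      (fun ξ => ((besselSymbol 4 ξ : ℝ) : ℂ)) * fun ξ => ((planeSymbol ε ω ξ ^ 2 : ℝ) : ℂ) := by
    ext ξ
    simp only [principalSymbol, Pi.mul_apply]
    push_cast
    ring
  have hc4 := coe_realBCF continuous_besselSymbol (abs_besselSymbol_le h4)
  rw [opA_opA_eq_fourierMultiplierCLM, toTemperedDistribution_fourierMul (by rw [hc4]; exact hg4),
    toTemperedDistribution_fourierMul
      (by rw [coe_realBCF_principalSymbol hk, hprod]; exact hg4.mul ha),
    hc4, coe_realBCF_principalSymbol hk, fourierMultiplierCLM_fourierMultiplierCLM_apply hg4 ha,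
    hprod]

/-- With q² = a² + κ this is a² = q²(1 - κ/q²), divided by (1 + ‖ξ‖²)². All factors are now bounded,
so the identity holds between operators on L². -/
theorem realBCF_principalSymbol_eq (hk : 0 < 1 + 2 * ε * ω) (hκ : 1 ≤ κ) :
    realBCF (principalSymbol ε ω) =
      (1 - (κ : ℂ) • ((realBCF fun ξ => (formSymbol ε ω κ ξ)⁻¹) *
        realBCF fun ξ => (formSymbol ε ω κ ξ)⁻¹)) *
      (realBCF (invRatioSymbol ε ω κ) * realBCF (invRatioSymbol ε ω κ)) := by
  ext ξ
  simp only [BoundedContinuousFunction.mul_apply, BoundedContinuousFunction.sub_apply,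
    BoundedContinuousFunction.smul_apply, BoundedContinuousFunction.coe_one, Pi.one_apply,
    realBCF_invRatioSymbol_apply hk hκ, coe_realBCF_principalSymbol hk,
    realBCF_apply (continuous_inv_formSymbol hκ) (abs_inv_formSymbol_le hκ), smul_eq_mul]
  norm_cast
  rw [principalSymbol, besselSymbol_four, invRatioSymbol]
  have h1 := formSymbol_sq (ε := ε) (ω := ω) hκ ξ
  have h2 := formSymbol_pos (ε := ε) (ω := ω) hκ ξ
  have h3 : planeSymbol ε ω ξ ^ 2 = formSymbol ε ω κ ξ ^ 2 - κ := by linarith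
  rw [h3]
  field_simp

/-- The range of `N²` is `H⁴(ℝ²)`, where the principal part acts as `N⁻² - κ`. -/
theorem memH_four_iff (hk : 0 < 1 + 2 * ε * ω) (hκ : 1 ≤ κ) {w : L2Plane} :
    MemH 4 w ↔ ∃ h, w = planeN ε ω κ (planeN ε ω κ h) := by
  rw [memH_iff (by norm_num)]
  constructor
  · rintro ⟨g, rfl⟩
    refine ⟨fourierMul (realBCF (invRatioSymbol ε ω κ) * realBCF (invRatioSymbol ε ω κ)) g, ?_⟩
    simp only [planeN, ← fourierMul_mul_apply]
    rw [realBCF_besselSymbol_four_eq, realBCF_besselSymbol_two_eq hk hκ]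
    congr 2
    ring
  · rintro ⟨h, rfl⟩
    refine ⟨fourierMul (realBCF (ratioSymbol ε ω κ) * realBCF (ratioSymbol ε ω κ)) h, ?_⟩
    simp only [planeN, ← fourierMul_mul_apply]
    rw [realBCF_besselSymbol_four_eq, realBCF_inv_formSymbol_eq hk hκ]
    congr 2
    ring

theorem opA_opA_planeN (hk : 0 < 1 + 2 * ε * ω) (hκ : 1 ≤ κ) (h : L2Plane) :
    opA ε ω (opA ε ω ((planeN ε ω κ (planeN ε ω κ h) : L2Plane) : 𝓢'(Plane, ℂ))) =
      ((h - (κ : ℂ) • planeN ε ω κ (planeN ε ω κ h) : L2Plane) : 𝓢'(Plane, ℂ)) := by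
  have h1 : planeN ε ω κ (planeN ε ω κ h) = fourierMul (realBCF (besselSymbol 4))
      (fourierMul (realBCF (ratioSymbol ε ω κ) * realBCF (ratioSymbol ε ω κ)) h) := by
    simp only [planeN, ← fourierMul_mul_apply]
    rw [realBCF_besselSymbol_four_eq, realBCF_inv_formSymbol_eq hk hκ]
    congr 2
    ring
  have h2 : (realBCF (invRatioSymbol ε ω κ) * realBCF (invRatioSymbol ε ω κ)) *
      (realBCF (ratioSymbol ε ω κ) * realBCF (ratioSymbol ε ω κ)) = 1 := by
    ext ξ
    simp only [BoundedContinuousFunction.mul_apply, realBCF_invRatioSymbol_apply hk hκ,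
      realBCF_ratioSymbol_apply hk hκ, BoundedContinuousFunction.coe_one, Pi.one_apply]
    norm_cast
    have h2 := formSymbol_pos (ε := ε) (ω := ω) hκ ξ
    rw [ratioSymbol, invRatioSymbol]
    field_simp
  rw [h1, toTemperedDistribution_principal hk, ← h1, ← fourierMul_mul_apply,
    realBCF_principalSymbol_eq hk hκ, mul_assoc, h2, mul_one, fourierMul_sub_apply,
    fourierMul_smul_apply, fourierMul_one, fourierMul_mul_apply, planeN]
  rfl

/-- The range of `N` is `H²(ℝ²)`, with equivalent norms. -/
theorem exists_equiv_normH_two (hk : 0 < 1 + 2 * ε * ω) (hκ : 1 ≤ κ) :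
    ∃ C : ℝ, 0 ≤ C ∧
      (∀ w, MemH 2 w → ∃ v, w = planeN ε ω κ v ∧ ‖v‖ ≤ C * normH 2 w) ∧
      ∀ v, MemH 2 (planeN ε ω κ v) ∧ normH 2 (planeN ε ω κ v) ≤ C * ‖v‖ := by
  refine ⟨max ‖fourierMul (realBCF (invRatioSymbol ε ω κ))‖
    ‖fourierMul (realBCF (ratioSymbol ε ω κ))‖, by positivity, fun w hw => ?_, fun v => ?_⟩
  · obtain ⟨g, rfl⟩ := (memH_iff zero_le_two).1 hw
    refine ⟨fourierMul (realBCF (invRatioSymbol ε ω κ)) g, ?_, ?_⟩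
    · rw [planeN, ← fourierMul_mul_apply, ← realBCF_besselSymbol_two_eq hk hκ]
    · rw [normH_fourierMul zero_le_two]
      exact ContinuousLinearMap.le_of_opNorm_le _ (le_max_left _ _) g
  · have h1 : planeN ε ω κ v = fourierMul (realBCF (besselSymbol 2))
        (fourierMul (realBCF (ratioSymbol ε ω κ)) v) := by
      rw [planeN, ← fourierMul_mul_apply, ← realBCF_inv_formSymbol_eq hk hκ]
    rw [h1, normH_fourierMul zero_le_two]
    exact ⟨memH_fourierMul zero_le_two _,
      ContinuousLinearMap.le_of_opNorm_le _ (le_max_right _ _) v⟩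

variable {s b : ℝ} {u : ℝ → ℝ}

theorem IsRoll.continuous_potential (hu : IsRoll s b ε ω u) : Continuous (potential s b ε u) := by
  have := hu.contDiff.continuous
  unfold potential
  fun_prop

theorem IsRoll.periodic_potential (hu : IsRoll s b ε ω u) :
    Function.Periodic (potential s b ε u) (2 * Real.pi) := fun x => by
  simp only [potential, hu.periodic x]

theorem IsRoll.exists_abs_potential_le (hu : IsRoll s b ε ω u) :
    ∃ C : ℝ, 0 ≤ C ∧ ∀ x, |potential s b ε u x| ≤ C := by
  obtain ⟨C, hC⟩ := isCompact_Icc.exists_bound_of_continuousOn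
    (s := Set.Icc (0 : ℝ) (2 * Real.pi)) hu.continuous_potential.continuousOn
  have h : ∀ x, |potential s b ε u x| ≤ C := fun x => by
    obtain ⟨y, hy, hxy⟩ := hu.periodic_potential.exists_mem_Ico₀ Real.two_pi_pos x
    rw [hxy]
    exact hC y ⟨hy.1, hy.2.le⟩
  exact ⟨C, (abs_nonneg _).trans (h 0), h⟩

/-- Multiplication by the potential on `L²(ℝ²)`. -/
def planeV (s b ε : ℝ) (u : ℝ → ℝ) : L2Plane →L[ℂ] L2Plane :=
  mulOp volume (realBCF fun z : Plane => potential s b ε u (z 0))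

theorem IsRoll.planePotential_apply (hu : IsRoll s b ε ω u) (z : Plane) :
    (realBCF fun z : Plane => potential s b ε u (z 0)) z = (potential s b ε u (z 0) : ℂ) := by
  obtain ⟨C, -, hC⟩ := hu.exists_abs_potential_le
  have := hu.continuous_potential
  exact realBCF_apply (f := fun z : Plane => potential s b ε u (z 0)) (by fun_prop)
    (fun z => hC (z 0)) z

theorem isSelfAdjoint_planeV : IsSelfAdjoint (planeV s b ε u) :=
  isSelfAdjoint_mulOp (conj_realBCF _)

theorem IsRoll.norm_planeV_le (hu : IsRoll s b ε ω u) {C : ℝ}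
    (hC : ∀ x, |potential s b ε u x| ≤ C) : ‖planeV s b ε u‖ ≤ C :=
  norm_mulOp_le_of_forall ((abs_nonneg _).trans (hC 0)) fun z => by
    rw [hu.planePotential_apply, Complex.norm_real]
    exact hC _

/-- On H⁴ the principal part is -(N⁻² - κ), so κ cancels in κw - ℒw = N⁻²w - Vw. The right side has
the shape of `eq_perturbedResolvent_iff`. -/
theorem IsRoll.linearizedGraph_iff (hu : IsRoll s b ε ω u) (hk : 0 < 1 + 2 * ε * ω)
    (hκ : 1 ≤ κ) {w g : L2Plane} :
    LinearizedGraph s b ε ω u w g ↔ ∃ h, w = planeN ε ω κ (planeN ε ω κ h) ∧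
      (κ : ℂ) • w - g = h - planeV s b ε u w := by
  have hq : ∀ q : L2Plane, (∀ᵐ z : Plane, q z = (potential s b ε u (z 0) : ℂ) * w z) ↔
      q = planeV s b ε u w := fun q => by
    have h1 := coeFn_mulOp (realBCF fun z : Plane => potential s b ε u (z 0)) w
    simp only [hu.planePotential_apply] at h1
    constructor
    · intro h
      refine Lp.ext ?_
      filter_upwards [h, h1] with z hz hz1
      rw [hz, planeV, hz1]
    · rintro rfl
      exact h1
  simp only [LinearizedGraph, hq, exists_eq_left]
  rw [memH_four_iff hk hκ]
  have key : ∀ h : L2Plane, w = planeN ε ω κ (planeN ε ω κ h) →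
      ((g : 𝓢'(Plane, ℂ)) = -opA ε ω (opA ε ω (w : 𝓢'(Plane, ℂ))) +
        ((planeV s b ε u w : L2Plane) : 𝓢'(Plane, ℂ)) ↔
      (κ : ℂ) • w - g = h - planeV s b ε u w) := fun h hw => by
    have h1 : -opA ε ω (opA ε ω (w : 𝓢'(Plane, ℂ))) +
        ((planeV s b ε u w : L2Plane) : 𝓢'(Plane, ℂ)) =
        ((-(h - (κ : ℂ) • w) + planeV s b ε u w : L2Plane) : 𝓢'(Plane, ℂ)) := by
      have h2 := opA_opA_planeN (ε := ε) (ω := ω) hk hκ h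
      rw [← hw] at h2
      rw [h2]
      simp only [← Lp.toTemperedDistributionCLM_apply, map_add, map_neg]
    rw [h1]
    constructor
    · intro h3
      rw [injective_toTemperedDistribution h3]
      abel
    · intro h3
      congr 1
      have : g = (κ : ℂ) • w - ((κ : ℂ) • w - g) := by abel
      rw [this, h3]
      abel
  constructor
  · rintro ⟨⟨h, hw⟩, hg⟩
    exact ⟨h, hw, (key h hw).1 hg⟩
  · rintro ⟨h, hw, hg⟩
    exact ⟨⟨h, hw⟩, (key h hw).2 hg⟩

end Plane

end SwiftHohenberg

namespace SwiftHohenberg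

open scoped BoundedContinuousFunction ComplexConjugate FourierTransform

/-! ### Diagonal operators -/

section Diagonal

variable {H ι : Type*} [NormedAddCommGroup H] [InnerProductSpace ℂ H] [CompleteSpace H]
  (e : HilbertBasis ι ℂ H)

/-- The operator with eigenvectors `e i` and summable eigenvalues `m i`. -/
def diagOp (m : ι → ℝ) : H →L[ℂ] H :=
  ∑' i, (m i : ℂ) • InnerProductSpace.rankOne ℂ (e i) (e i)

theorem norm_basis (i : ι) : ‖e i‖ = 1 := e.orthonormal.1 i

theorem hasSum_diagOp {m : ι → ℝ} (hm : Summable m) :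
    HasSum (fun i => (m i : ℂ) • InnerProductSpace.rankOne ℂ (e i) (e i)) (diagOp e m) := by
  refine Summable.hasSum (Summable.of_norm_bounded hm.abs fun i => ?_)
  simp [norm_smul, norm_basis]

theorem inner_diagOp {m : ι → ℝ} (hm : Summable m) (i : ι) (x : H) :
    inner ℂ (e i) (diagOp e m x) = (m i : ℂ) * inner ℂ (e i) x := by
  classical
  have h1 := ((hasSum_diagOp e hm).mapL (ContinuousLinearMap.apply ℂ H x)).mapL
    (innerSL ℂ (e i))
  have h2 : HasSum (fun j => (innerSL ℂ (e i)) ((ContinuousLinearMap.apply ℂ H x)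
      ((m j : ℂ) • InnerProductSpace.rankOne ℂ (e j) (e j)))) ((m i : ℂ) * inner ℂ (e i) x) := by
    have h3 : (innerSL ℂ (e i)) ((ContinuousLinearMap.apply ℂ H x)
      ((m i : ℂ) • InnerProductSpace.rankOne ℂ (e i) (e i))) = (m i : ℂ) * inner ℂ (e i) x := by
      simp [norm_basis]
    rw [← h3]
    refine hasSum_single i fun j hj => ?_
    have : inner ℂ (e i) (e j) = 0 := e.orthonormal.2 hj.symm
    simp [this]
  exact h1.unique h2

/-- Summability of the eigenvalues makes the operator a norm limit of finite-rank operators. -/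
theorem isCompactOperator_diagOp {m : ι → ℝ} (hm : Summable m) :
    IsCompactOperator (diagOp e m) := by
  refine isCompactOperator_of_tendsto (l := atTop) (hasSum_diagOp e hm)
    (Eventually.of_forall fun s => ?_)
  classical
  induction s using Finset.induction_on with
  | empty => simpa using isCompactOperator_zero
  | insert i s hi ih =>
    rw [Finset.sum_insert hi]
    refine IsCompactOperator.add
      (f := ((m i : ℂ) • InnerProductSpace.rankOne ℂ (e i) (e i) : H →L[ℂ] H)) ?_ ih
    have h1 : ((m i : ℂ) • InnerProductSpace.rankOne ℂ (e i) (e i) : H →L[ℂ] H) =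
        (ContinuousLinearMap.toSpanSingleton ℂ ((m i : ℂ) • e i)) ∘L innerSL ℂ (e i) := by
      ext x
      simp only [_root_.smul_apply, InnerProductSpace.rankOne_apply,
        ContinuousLinearMap.coe_comp, Function.comp_apply, innerSL_apply_apply,
        ContinuousLinearMap.toSpanSingleton_apply]
      rw [smul_comm]
    rw [h1]
    have h2 : IsCompactOperator (innerSL ℂ (e i)) := isCompactOperator_of_locallyCompactSpace_dom _
    exact h2.clm_comp (ContinuousLinearMap.toSpanSingleton ℂ ((m i : ℂ) • e i))

theorem hasSum_norm_sq_inner (x : H) : HasSum (fun i => ‖inner ℂ (e i) x‖ ^ 2) (‖x‖ ^ 2) := by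
  have h := (e.hasSum_inner_mul_inner x x).mapL Complex.reCLM
  simp only [Complex.reCLM_apply, re_inner_self] at h
  refine h.congr_fun ?_
  intro i
  rw [← inner_conj_symm x (e i), Complex.conj_mul']
  norm_cast

theorem norm_diagOp_le {m : ι → ℝ} (hm : Summable m) {C : ℝ} (hC : 0 ≤ C) (h : ∀ i, |m i| ≤ C) :
    ‖diagOp e m‖ ≤ C := by
  refine ContinuousLinearMap.opNorm_le_bound _ hC fun x => ?_
  refine le_of_sq_le_sq ?_ (by positivity)
  rw [mul_pow]
  refine hasSum_le (fun i => ?_) (hasSum_norm_sq_inner e _) ((hasSum_norm_sq_inner e x).mul_left _)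
  rw [inner_diagOp e hm, norm_mul, mul_pow, Complex.norm_real]
  gcongr
  exact h i

theorem ext_inner_basis {x y : H} (h : ∀ i, inner ℂ (e i) x = inner ℂ (e i) y) : x = y := by
  apply e.repr.injective
  ext i
  rw [e.repr_apply_apply, e.repr_apply_apply, h]

theorem isSelfAdjoint_diagOp {m : ι → ℝ} (hm : Summable m) : IsSelfAdjoint (diagOp e m) := by
  rw [ContinuousLinearMap.isSelfAdjoint_iff_isSymmetric]
  intro x y
  rw [ContinuousLinearMap.coe_coe, ← (e.hasSum_inner_mul_inner _ y).tsum_eq,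
    ← (e.hasSum_inner_mul_inner x _).tsum_eq]
  refine tsum_congr fun i => ?_
  rw [inner_diagOp e hm, ← inner_conj_symm _ (e i), inner_diagOp e hm, map_mul, inner_conj_symm,
    Complex.conj_ofReal]
  ring

theorem injective_diagOp {m : ι → ℝ} (hm : Summable m) (h0 : ∀ i, m i ≠ 0) :
    Function.Injective (diagOp e m) := by
  intro x y h
  refine ext_inner_basis e fun i => ?_
  have h1 := congrArg (inner ℂ (e i)) h
  rw [inner_diagOp e hm, inner_diagOp e hm] at h1
  exact mul_left_cancel₀ (by exact_mod_cast h0 i) h1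

theorem diagOp_basis {m : ι → ℝ} (hm : Summable m) (i : ι) :
    diagOp e m (e i) = (m i : ℂ) • e i := by
  classical
  refine ext_inner_basis e fun j => ?_
  rw [inner_diagOp e hm, inner_smul_right]
  rcases eq_or_ne j i with rfl | hj
  · rfl
  · rw [e.orthonormal.2 hj]; simp

/-- A square summable family is the family of coefficients of a vector. -/
theorem exists_inner_eq {c : ι → ℂ} (hc : Summable fun i => ‖c i‖ ^ 2) :
    ∃ x : H, ∀ i, inner ℂ (e i) x = c i := by
  have h : Memℓp c 2 := by
    rw [memℓp_gen_iff (by norm_num)]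
    simpa using hc
  refine ⟨e.repr.symm ⟨c, h⟩, fun i => ?_⟩
  rw [← e.repr_apply_apply, LinearIsometryEquiv.apply_symm_apply]

/-- The range of the square of a diagonal operator. -/
theorem exists_eq_diagOp_diagOp_iff {m : ι → ℝ} (hm : Summable m) (h0 : ∀ i, m i ≠ 0) {x : H} :
    (∃ h, x = diagOp e m (diagOp e m h)) ↔
      Summable fun i => ‖((m i : ℂ) ^ 2)⁻¹ * inner ℂ (e i) x‖ ^ 2 := by
  constructor
  · rintro ⟨h, rfl⟩
    refine (hasSum_norm_sq_inner e h).summable.congr fun i => ?_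
    have : (m i : ℂ) ≠ 0 := by exact_mod_cast h0 i
    rw [inner_diagOp e hm, inner_diagOp e hm]
    congr 2
    field_simp
  · intro h
    obtain ⟨y, hy⟩ := exists_inner_eq e h
    refine ⟨y, ext_inner_basis e fun i => ?_⟩
    have : (m i : ℂ) ≠ 0 := by exact_mod_cast h0 i
    rw [inner_diagOp e hm, inner_diagOp e hm, hy]
    field_simp

end Diagonal

end SwiftHohenberg

namespace SwiftHohenberg

open scoped BoundedContinuousFunction ComplexConjugate FourierTransform

/-! ### The Bloch operators on the circle -/

section Circle

variable {s b ε ω κ : ℝ} {u : ℝ → ℝ} {σ : ℝ × ℝ}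

/-- The frequency of the Bloch wave `exp (i (n + σ₁) x + i σ₂ y)`. -/
def blochPoint (σ : ℝ × ℝ) (n : ℤ) : Plane :=
  !₂[(n + σ.1) / (2 * Real.pi), σ.2 / (2 * Real.pi)]

theorem planeSymbol_blochPoint (σ : ℝ × ℝ) (n : ℤ) :
    planeSymbol ε ω (blochPoint σ n) = 1 - (1 + 2 * ε * ω) * (n + σ.1) ^ 2 - σ.2 ^ 2 := by
  have h0 : 2 * Real.pi * ((n + σ.1) / (2 * Real.pi)) = n + σ.1 := by field_simp
  have h1 : 2 * Real.pi * (σ.2 / (2 * Real.pi)) = σ.2 := by field_simp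
  simp only [planeSymbol, blochPoint, PiLp.toLp_apply, Matrix.cons_val_zero, Matrix.cons_val_one,
    h0, h1]

/-- The Bloch symbol is the plane symbol sampled on a shifted lattice, so the symbol estimates on
the plane serve on the circle too. -/
theorem blochSymbol_eq (σ : ℝ × ℝ) (n : ℤ) :
    blochSymbol ε ω σ n = -((planeSymbol ε ω (blochPoint σ n) ^ 2 : ℝ) : ℂ) := by
  rw [planeSymbol_blochPoint, blochSymbol]
  have h : (Complex.I * n + Complex.I * σ.1) ^ 2 = -((n : ℂ) + σ.1) ^ 2 := by
    linear_combination ((n : ℂ) + σ.1) ^ 2 * Complex.I_sq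
  rw [h]
  push_cast
  ring

theorem norm_sq_blochPoint (σ : ℝ × ℝ) (n : ℤ) :
    (2 * Real.pi) ^ 2 * ‖blochPoint σ n‖ ^ 2 = (n + σ.1) ^ 2 + σ.2 ^ 2 := by
  rw [norm_sq_eq_coords]
  simp only [blochPoint, PiLp.toLp_apply, Matrix.cons_val_zero, Matrix.cons_val_one]
  field_simp

theorem exists_formSymbol_blochPoint_le (hk : 0 < 1 + 2 * ε * ω) (hκ : 1 ≤ κ) (σ : ℝ × ℝ) :
    ∃ C : ℝ, 0 < C ∧ ∀ n : ℤ, formSymbol ε ω κ (blochPoint σ n) ≤ C * (1 + (n : ℝ) ^ 2) := by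
  obtain ⟨C, hC, h⟩ := exists_formSymbol_le (ε := ε) (ω := ω) hk hκ
  -- From (2π)² ≥ 1 and (n + σ₁)² ≤ 2n² + 2σ₁².
  refine ⟨C * (3 + 2 * σ.1 ^ 2 + σ.2 ^ 2), by positivity, fun n => (h _).trans ?_⟩
  rw [mul_assoc]
  gcongr
  have h1 := norm_sq_blochPoint σ n
  have h2 : 1 ≤ (2 * Real.pi) ^ 2 := by nlinarith [Real.pi_gt_three]
  have h3 : ‖blochPoint σ n‖ ^ 2 ≤ (n + σ.1) ^ 2 + σ.2 ^ 2 := by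
    nlinarith [sq_nonneg ‖blochPoint σ n‖]
  nlinarith [sq_nonneg ((n : ℝ) - σ.1), mul_nonneg (sq_nonneg σ.1) (sq_nonneg (n : ℝ)),
    mul_nonneg (sq_nonneg σ.2) (sq_nonneg (n : ℝ)), sq_nonneg (n : ℝ)]

theorem exists_one_add_sq_le_formSymbol (hk : 0 < 1 + 2 * ε * ω) (hκ : 1 ≤ κ) (σ : ℝ × ℝ) :
    ∃ C : ℝ, 0 < C ∧ ∀ n : ℤ, 1 + (n : ℝ) ^ 2 ≤ C * formSymbol ε ω κ (blochPoint σ n) := by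
  obtain ⟨C, hC, h⟩ := exists_one_add_norm_sq_le_formSymbol (ε := ε) (ω := ω) hk hκ
  -- From n² ≤ 2(n + σ₁)² + 2σ₁² and (n + σ₁)² ≤ (2π)²‖ξ‖² at the Bloch point ξ.
  refine ⟨(1 + 2 * (2 * Real.pi) ^ 2 + 2 * σ.1 ^ 2) * C, by positivity, fun n => ?_⟩
  rw [mul_assoc]
  refine le_trans ?_ (mul_le_mul_of_nonneg_left (h (blochPoint σ n)) (by positivity))
  have h1 := norm_sq_blochPoint σ n
  set P := (2 * Real.pi) ^ 2 with hP
  set x := ‖blochPoint σ n‖ ^ 2 with hx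
  have hx0 : 0 ≤ x := by positivity
  have hP0 : 0 ≤ P := by positivity
  nlinarith [sq_nonneg ((n : ℝ) + 2 * σ.1), mul_nonneg (sq_nonneg σ.1) hx0, sq_nonneg σ.2,
    mul_nonneg hP0 hx0]

/-- The eigenvalues `(α_n² + κ)^(-1/2)` of the diagonal operator on the circle. -/
def blochWeight (ε ω κ : ℝ) (σ : ℝ × ℝ) (n : ℤ) : ℝ := (formSymbol ε ω κ (blochPoint σ n))⁻¹

theorem blochWeight_pos (hκ : 1 ≤ κ) (n : ℤ) : 0 < blochWeight ε ω κ σ n :=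
  inv_pos.2 (formSymbol_pos hκ _)

theorem summable_one_div_one_add_sq : Summable fun n : ℤ => (1 + (n : ℝ) ^ 2)⁻¹ := by
  refine Summable.of_norm_bounded_eventually
    (Real.summable_one_div_int_pow (p := 2).2 one_lt_two) ?_
  filter_upwards [(Set.finite_singleton (0 : ℤ)).compl_mem_cofinite] with n hn
  have hn0 : (n : ℝ) ≠ 0 := by exact_mod_cast hn
  rw [Real.norm_of_nonneg (by positivity), one_div]
  gcongr
  linarith

theorem summable_blochWeight (hk : 0 < 1 + 2 * ε * ω) (hκ : 1 ≤ κ) :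
    Summable (blochWeight ε ω κ σ) := by
  obtain ⟨C, hC, h⟩ := exists_one_add_sq_le_formSymbol hk hκ σ
  refine Summable.of_nonneg_of_le (fun n => (blochWeight_pos hκ n).le) (fun n => ?_)
    (summable_one_div_one_add_sq.mul_left C)
  have h1 := formSymbol_pos (ε := ε) (ω := ω) hκ (blochPoint σ n)
  rw [blochWeight, ← div_eq_mul_inv, inv_eq_one_div, div_le_div_iff₀ h1 (by positivity), one_mul]
  exact h n

/-- The diagonal operator `([1 + (1 + 2εω)(∂ₓ + iσ₁)² - σ₂²]² + κ)^(-1/2)` on `L²(𝕋)`. -/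
def circleN (ε ω κ : ℝ) (σ : ℝ × ℝ) : L2Circle →L[ℂ] L2Circle :=
  diagOp fourierBasis (blochWeight ε ω κ σ)

theorem norm_circleN_sq_le (hk : 0 < 1 + 2 * ε * ω) (hκ : 1 ≤ κ) :
    ‖circleN ε ω κ σ‖ ^ 2 ≤ κ⁻¹ := by
  have h : ‖circleN ε ω κ σ‖ ≤ (√κ)⁻¹ :=
    norm_diagOp_le _ (summable_blochWeight hk hκ) (by positivity) fun n =>
      abs_inv_formSymbol_le hκ _
  calc ‖circleN ε ω κ σ‖ ^ 2 ≤ (√κ)⁻¹ ^ 2 := by gcongr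
    _ = κ⁻¹ := by rw [inv_pow, Real.sq_sqrt (by linarith)]

theorem fourierCoeff_eq_inner (f : L2Circle) (n : ℤ) :
    fourierCoeff f n = inner ℂ (fourierBasis (T := 2 * Real.pi) n) f := by
  rw [← fourierBasis_repr, HilbertBasis.repr_apply_apply]

/-- The inverse weights are comparable to 1 + n², with constants depending on σ, so the range of the
squared operator does not depend on σ. -/
theorem memH4Circle_iff (hk : 0 < 1 + 2 * ε * ω) (hκ : 1 ≤ κ) {W : L2Circle} :
    MemH4Circle W ↔ ∃ h, W = circleN ε ω κ σ (circleN ε ω κ σ h) := by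
  simp only [circleN]
  rw [exists_eq_diagOp_diagOp_iff _ (summable_blochWeight hk hκ)
    fun n => (blochWeight_pos hκ n).ne', MemH4Circle]
  have h0 : ∀ n : ℤ, ‖((blochWeight ε ω κ σ n : ℂ) ^ 2)⁻¹ *
      inner ℂ (fourierBasis (T := 2 * Real.pi) n) W‖ ^ 2 =
      formSymbol ε ω κ (blochPoint σ n) ^ 4 * ‖fourierCoeff W n‖ ^ 2 := fun n => by
    rw [norm_mul, mul_pow, fourierCoeff_eq_inner, norm_inv, norm_pow, Complex.norm_real,
      Real.norm_of_nonneg (blochWeight_pos hκ n).le, blochWeight]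
    congr 1
    simp only [inv_pow, inv_inv]
    ring
  simp only [h0]
  constructor
  · intro h
    obtain ⟨C, hC, h1⟩ := exists_formSymbol_blochPoint_le hk hκ σ
    refine Summable.of_nonneg_of_le (fun n => by positivity) (fun n => ?_) (h.mul_left (C ^ 4))
    rw [← mul_assoc, ← mul_pow]
    gcongr
    · exact (formSymbol_pos hκ _).le
    · exact h1 n
  · intro h
    obtain ⟨C, hC, h1⟩ := exists_one_add_sq_le_formSymbol hk hκ σ
    refine Summable.of_nonneg_of_le (fun n => by positivity) (fun n => ?_) (h.mul_left (C ^ 4))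
    rw [← mul_assoc, ← mul_pow]
    gcongr
    exact h1 n

/-- The potential on the circle. -/
def circlePotential (s b ε : ℝ) (u : ℝ → ℝ) : Circle2Pi → ℝ :=
  AddCircle.liftIco (2 * Real.pi) 0 (potential s b ε u)

theorem IsRoll.circlePotential_coe (hu : IsRoll s b ε ω u) (x : ℝ) :
    circlePotential s b ε u (x : Circle2Pi) = potential s b ε u x := by
  obtain ⟨m, hm, -⟩ := existsUnique_add_zsmul_mem_Ico Real.two_pi_pos x 0
  have h1 : ((x + m • (2 * Real.pi) : ℝ) : Circle2Pi) = (x : Circle2Pi) := by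
    rw [AddCircle.coe_add, AddCircle.coe_zsmul, AddCircle.coe_period, smul_zero, add_zero]
  rw [← h1, circlePotential, AddCircle.liftIco_coe_apply hm]
  exact hu.periodic_potential.zsmul m x

theorem IsRoll.continuous_circlePotential (hu : IsRoll s b ε ω u) :
    Continuous (circlePotential s b ε u) := by
  refine AddCircle.liftIco_continuous ?_ hu.continuous_potential.continuousOn
  exact (hu.periodic_potential 0).symm

theorem IsRoll.abs_circlePotential_le (hu : IsRoll s b ε ω u) {C : ℝ}
    (hC : ∀ x, |potential s b ε u x| ≤ C) (θ : Circle2Pi) :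
    |circlePotential s b ε u θ| ≤ C := by
  induction θ using QuotientAddGroup.induction_on with
  | H x =>
    have := hu.circlePotential_coe x
    rw [this]
    exact hC x

theorem IsRoll.realBCF_circlePotential_apply (hu : IsRoll s b ε ω u) (θ : Circle2Pi) :
    realBCF (circlePotential s b ε u) θ = (circlePotential s b ε u θ : ℂ) := by
  obtain ⟨C, -, hC⟩ := hu.exists_abs_potential_le
  exact realBCF_apply hu.continuous_circlePotential (hu.abs_circlePotential_le hC) θ

/-- Multiplication by the potential on `L²(𝕋)`. -/
def circleV (s b ε : ℝ) (u : ℝ → ℝ) : L2Circle →L[ℂ] L2Circle :=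
  mulOp AddCircle.haarAddCircle (realBCF (circlePotential s b ε u))

theorem isSelfAdjoint_circleV : IsSelfAdjoint (circleV s b ε u) :=
  isSelfAdjoint_mulOp (conj_realBCF _)

theorem IsRoll.norm_circleV_le (hu : IsRoll s b ε ω u) {C : ℝ}
    (hC : ∀ x, |potential s b ε u x| ≤ C) : ‖circleV s b ε u‖ ≤ C :=
  norm_mulOp_le_of_forall ((abs_nonneg _).trans (hC 0)) fun θ => by
    rw [hu.realBCF_circlePotential_apply, Complex.norm_real]
    exact hu.abs_circlePotential_le hC _

theorem IsRoll.blochGraph_iff (hu : IsRoll s b ε ω u) (hk : 0 < 1 + 2 * ε * ω)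
    (hκ : 1 ≤ κ) {W G : L2Circle} :
    BlochGraph s b ε ω u σ W G ↔ ∃ h, W = circleN ε ω κ σ (circleN ε ω κ σ h) ∧
      (κ : ℂ) • W - G = h - circleV s b ε u W := by
  have hq : ∀ Q : L2Circle, (∀ᵐ θ ∂(AddCircle.haarAddCircle (T := 2 * Real.pi)),
      Q θ = ((AddCircle.liftIco (2 * Real.pi) 0 (potential s b ε u) θ : ℝ) : ℂ) * W θ) ↔
      Q = circleV s b ε u W := fun Q => by
    have h1 := coeFn_mulOp (realBCF (circlePotential s b ε u)) W
    simp only [hu.realBCF_circlePotential_apply] at h1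
    constructor
    · intro h
      refine Lp.ext ?_
      filter_upwards [h, h1] with z hz hz1
      rw [hz, circleV, hz1, circlePotential]
    · rintro rfl
      exact h1
  simp only [BlochGraph, hq, exists_eq_left]
  rw [memH4Circle_iff (σ := σ) hk hκ]
  have key : ∀ h : L2Circle, W = circleN ε ω κ σ (circleN ε ω κ σ h) →
      ((∀ n : ℤ, fourierCoeff G n = blochSymbol ε ω σ n * fourierCoeff W n +
        fourierCoeff (circleV s b ε u W) n) ↔
      (κ : ℂ) • W - G = h - circleV s b ε u W) := fun h hW => by
    have hWn : ∀ n : ℤ, ((planeSymbol ε ω (blochPoint σ n) ^ 2 : ℝ) + κ : ℂ) *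
        inner ℂ (fourierBasis (T := 2 * Real.pi) n) W =
        inner ℂ (fourierBasis (T := 2 * Real.pi) n) h := fun n => by
      rw [hW, circleN, inner_diagOp _ (summable_blochWeight hk hκ),
        inner_diagOp _ (summable_blochWeight hk hκ), ← Complex.ofReal_add, ← formSymbol_sq hκ,
        blochWeight]
      have : (formSymbol ε ω κ (blochPoint σ n) : ℂ) ≠ 0 := by
        exact_mod_cast (formSymbol_pos hκ _).ne'
      push_cast
      field_simp
    have hiff : (κ : ℂ) • W - G = h - circleV s b ε u W ↔
        ∀ n : ℤ, inner ℂ (fourierBasis (T := 2 * Real.pi) n) ((κ : ℂ) • W - G) =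
          inner ℂ (fourierBasis (T := 2 * Real.pi) n) (h - circleV s b ε u W) :=
      ⟨fun h n => by rw [h], fun h => ext_inner_basis _ h⟩
    rw [hiff]
    refine forall_congr' fun n => ?_
    rw [fourierCoeff_eq_inner, fourierCoeff_eq_inner, fourierCoeff_eq_inner, inner_sub_right,
      inner_sub_right, ← hWn, blochSymbol_eq, inner_smul_right]
    constructor
    · intro h
      rw [h]
      ring
    · intro h
      linear_combination -h
  constructor
  · rintro ⟨⟨h, hw⟩, hg⟩
    exact ⟨h, hw, (key h hw).1 hg⟩
  · rintro ⟨h, hw, hg⟩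
    exact ⟨⟨h, hw⟩, (key h hw).2 hg⟩

end Circle

end SwiftHohenberg

namespace SwiftHohenberg

open scoped BoundedContinuousFunction ComplexConjugate FourierTransform

/-! ### Eigenvalues and form bounds of the Bloch operators; decay of the potential's Fourier
coefficients -/

section BlochSpectrum

variable {s b ε ω κ C : ℝ} {u : ℝ → ℝ} {σ : ℝ × ℝ}

theorem mul_le_half_of_le {v n : ℝ} (hC : 0 ≤ C) (hκC : 2 * C + 1 ≤ κ) (hv : v ≤ C)
    (hn0 : 0 ≤ n) (hn : n ≤ κ⁻¹) : v * n ≤ 1 / 2 := by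
  have hκ : 0 < κ := by linarith
  calc v * n ≤ C * κ⁻¹ := mul_le_mul hv hn hn0 hC
    _ ≤ 1 / 2 := by rw [← div_eq_mul_inv, div_le_iff₀ hκ]; linarith

theorem IsRoll.circle_form_small (hu : IsRoll s b ε ω u) (hk : 0 < 1 + 2 * ε * ω)
    (hC0 : 0 ≤ C) (hC : ∀ x, |potential s b ε u x| ≤ C) (hκ : 2 * C + 1 ≤ κ) :
    ‖circleV s b ε u‖ * ‖circleN ε ω κ σ‖ ^ 2 ≤ 1 / 2 :=
  mul_le_half_of_le hC0 hκ (hu.norm_circleV_le hC) (sq_nonneg _)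
    (norm_circleN_sq_le hk (by linarith))

/-- The form of `B(σ)` is bounded by an eigenvalue of `B(σ)`. -/
theorem IsRoll.exists_blochEigenvalue_form_le (hu : IsRoll s b ε ω u) (hk : 0 < 1 + 2 * ε * ω)
    (hC0 : 0 ≤ C) (hC : ∀ x, |potential s b ε u x| ≤ C) (hκ : 2 * C + 1 ≤ κ) (σ : ℝ × ℝ) :
    ∃ μ ∈ blochEigenvalues s b ε ω u, ∀ h, (κ - μ) * ‖circleN ε ω κ σ (circleN ε ω κ σ h)‖ ^ 2 ≤
      ‖circleN ε ω κ σ h‖ ^ 2 - (inner ℂ (circleN ε ω κ σ (circleN ε ω κ σ h))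
        (circleV s b ε u (circleN ε ω κ σ (circleN ε ω κ σ h)))).re := by
  have hκ1 : 1 ≤ κ := by linarith
  have hsum := summable_blochWeight (σ := σ) hk hκ1
  have hN : IsSelfAdjoint (circleN ε ω κ σ) := isSelfAdjoint_diagOp _ hsum
  have hV : IsSelfAdjoint (circleV s b ε u) := isSelfAdjoint_circleV
  have hNV := hu.circle_form_small (σ := σ) hk hC0 hC hκ
  have hinj : Function.Injective (circleN ε ω κ σ) :=
    injective_diagOp _ hsum fun n => (blochWeight_pos hκ1 n).ne'
  set R := perturbedResolvent (circleN ε ω κ σ) (circleV s b ε u) with hRdef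
  have hR : 0 ≤ R := perturbedResolvent_nonneg hN hV hNV
  have hRinj : Function.Injective R := injective_perturbedResolvent hinj hNV
  have hRc : IsCompactOperator R := by
    have h1 : IsCompactOperator (circleN ε ω κ σ) := isCompactOperator_diagOp _ hsum
    have h2 : R = circleN ε ω κ σ ∘L
        (circleN ε ω κ σ * Ring.inverse (1 - circleV s b ε u * (circleN ε ω κ σ * circleN ε ω κ σ)))
        := by
      rw [hRdef, perturbedResolvent, mul_assoc]
      rfl
    rw [h2]
    exact h1.comp_clm _
  have hRne : R ≠ 0 := by
    intro h0
    have h1 : fourierBasis (T := 2 * Real.pi) 0 = 0 := hRinj (by rw [h0]; rfl)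
    have h2 := norm_basis (fourierBasis (T := 2 * Real.pi)) 0
    rw [h1, norm_zero] at h2
    exact zero_ne_one h2
  have hρ : 0 < ‖R‖ := norm_pos_iff.2 hRne
  obtain ⟨W, hW0, hW⟩ := exists_eigenvector_norm hR hRc hRne
  -- Since B(σ) = κ - R⁻¹, the largest eigenvalue ‖R‖ of R corresponds to the largest eigenvalue of
  -- B(σ).
  refine ⟨κ - ‖R‖⁻¹, ⟨σ, W, hW0, ?_⟩, fun h => ?_⟩
  · rw [hu.blochGraph_iff hk hκ1, ← eq_perturbedResolvent_iff hNV, ← sub_smul]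
    have h1 : (κ : ℂ) - ((κ - ‖R‖⁻¹ : ℝ) : ℂ) = ((‖R‖ : ℝ) : ℂ)⁻¹ := by
      push_cast; ring
    rw [h1, map_smul, ← hRdef, hW, smul_smul, inv_mul_cancel₀ (by exact_mod_cast hρ.ne'),
      one_smul]
  · have h1 := norm_apply_sq_le_norm_mul_inner hR
      (h - circleV s b ε u (circleN ε ω κ σ (circleN ε ω κ σ h)))
    rw [hRdef, inner_perturbedResolvent_eq (V := circleV s b ε u) hN hNV h,
      perturbedResolvent_apply_sub hNV, ← hRdef] at h1
    rw [sub_sub_cancel, inv_mul_le_iff₀ hρ]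
    exact h1

/-- The principal part is nonpositive, which here reads κ‖W‖² ≤ ‖Nh‖² with W = N²h. Pairing the
eigenvalue equation with W then leaves only the potential, bounded by C. -/
theorem IsRoll.blochEigenvalue_le (hu : IsRoll s b ε ω u) (hk : 0 < 1 + 2 * ε * ω)
    (hC0 : 0 ≤ C) (hC : ∀ x, |potential s b ε u x| ≤ C) {μ : ℝ}
    (hμ : μ ∈ blochEigenvalues s b ε ω u) : μ ≤ C := by
  obtain ⟨σ, W, hW0, hW⟩ := hμ
  set κ := 2 * C + 1 with hκdef
  have hκ1 : 1 ≤ κ := by linarith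
  have hN : IsSelfAdjoint (circleN ε ω κ σ) :=
    isSelfAdjoint_diagOp _ (summable_blochWeight hk hκ1)
  obtain ⟨h, hWh, hg⟩ := (hu.blochGraph_iff (κ := κ) hk hκ1).1 hW
  have hWpos : 0 < ‖W‖ ^ 2 := by
    have := norm_pos_iff.2 hW0
    positivity
  have h1 : (inner ℂ W h).re = ‖circleN ε ω κ σ h‖ ^ 2 := by
    rw [hWh, inner_apply_comm_of_isSelfAdjoint hN, re_inner_self]
  have h2 : κ * ‖W‖ ^ 2 ≤ ‖circleN ε ω κ σ h‖ ^ 2 := by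
    have h3 : ‖W‖ ≤ ‖circleN ε ω κ σ‖ * ‖circleN ε ω κ σ h‖ := by
      rw [hWh]; exact ContinuousLinearMap.le_opNorm _ _
    have h4 : ‖W‖ ^ 2 ≤ κ⁻¹ * ‖circleN ε ω κ σ h‖ ^ 2 :=
      calc ‖W‖ ^ 2 ≤ (‖circleN ε ω κ σ‖ * ‖circleN ε ω κ σ h‖) ^ 2 := by gcongr
        _ = ‖circleN ε ω κ σ‖ ^ 2 * ‖circleN ε ω κ σ h‖ ^ 2 := by ring
        _ ≤ _ := by gcongr; exact norm_circleN_sq_le hk hκ1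
    rwa [le_inv_mul_iff₀ (by linarith)] at h4
  have h5 : (inner ℂ W (circleV s b ε u W)).re ≤ C * ‖W‖ ^ 2 :=
    calc (inner ℂ W (circleV s b ε u W)).re ≤ ‖W‖ * ‖circleV s b ε u W‖ :=
          (Complex.re_le_norm _).trans (norm_inner_le_norm _ _)
      _ ≤ ‖W‖ * (C * ‖W‖) := by
          gcongr
          exact ContinuousLinearMap.le_of_opNorm_le _ (hu.norm_circleV_le hC) _
      _ = C * ‖W‖ ^ 2 := by ring
  have h6 := congrArg (fun x => (inner ℂ W x).re) hg
  simp only [← sub_smul, inner_sub_right, inner_smul_right, Complex.sub_re, h1] at h6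
  rw [← Complex.ofReal_sub, Complex.re_ofReal_mul, re_inner_self] at h6
  nlinarith

theorem IsRoll.isLUB_maxGrowthRate (hu : IsRoll s b ε ω u) (hk : 0 < 1 + 2 * ε * ω) :
    IsLUB (blochEigenvalues s b ε ω u) (maxGrowthRate s b ε ω u) := by
  obtain ⟨C, hC0, hC⟩ := hu.exists_abs_potential_le
  obtain ⟨μ, hμ, -⟩ := hu.exists_blochEigenvalue_form_le hk hC0 hC le_rfl 0
  exact Real.isLUB_sSup ⟨μ, hμ⟩ ⟨C, fun ν hν => hu.blochEigenvalue_le hk hC0 hC hν⟩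

/-! #### Fourier coefficients of the potential -/

/-- The Fourier coefficients of the potential. -/
def potentialCoeff (s b ε : ℝ) (u : ℝ → ℝ) (n : ℤ) : ℂ :=
  fourierCoeff (fun θ => (circlePotential s b ε u θ : ℂ)) n

/-- The matrix of the potential is Toeplitz; the dependence on n - m alone is what the window
averages rely on. -/
theorem IsRoll.inner_circleV_basis (hu : IsRoll s b ε ω u) (n m : ℤ) :
    inner ℂ (fourierBasis (T := 2 * Real.pi) n)
      (circleV s b ε u (fourierBasis (T := 2 * Real.pi) m)) = potentialCoeff s b ε u (n - m) := by
  rw [← fourierCoeff_eq_inner, potentialCoeff, fourierCoeff, fourierCoeff]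
  refine integral_congr_ae ?_
  have h1 := coeFn_mulOp (μ := AddCircle.haarAddCircle) (realBCF (circlePotential s b ε u))
    (fourierBasis (T := 2 * Real.pi) m)
  rw [coe_fourierBasis] at h1 ⊢
  filter_upwards [h1, coeFn_fourierLp (T := 2 * Real.pi) 2 m] with θ h2 h3
  rw [circleV, h2, h3, hu.realBCF_circlePotential_apply, smul_eq_mul, smul_eq_mul,
    show -(n - m) = -n + m by ring, fourier_add]
  ring

/-- The Bloch form inequality for finite sequences of Fourier coefficients. -/
theorem IsRoll.finite_bloch_form_le (hu : IsRoll s b ε ω u) (hk : 0 < 1 + 2 * ε * ω)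
    (σ : ℝ × ℝ) (S : Finset ℤ) (a : ℤ → ℂ) :
    (∑ n ∈ S, ∑ m ∈ S, conj (a n) * a m * potentialCoeff s b ε u (n - m)).re -
      ∑ n ∈ S, planeSymbol ε ω (blochPoint σ n) ^ 2 * ‖a n‖ ^ 2 ≤
      maxGrowthRate s b ε ω u * ∑ n ∈ S, ‖a n‖ ^ 2 := by
  obtain ⟨C, hC0, hC⟩ := hu.exists_abs_potential_le
  set κ := 2 * C + 1 with hκdef
  have hκ1 : 1 ≤ κ := by linarith
  obtain ⟨μ, hμ, hform⟩ := hu.exists_blochEigenvalue_form_le hk hC0 hC hκdef.ge σ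
  have hμle : μ ≤ maxGrowthRate s b ε ω u := (hu.isLUB_maxGrowthRate hk).1 hμ
  have hsum := summable_blochWeight (ε := ε) (ω := ω) (σ := σ) hk hκ1
  let e := fourierBasis (T := 2 * Real.pi)
  let q : ℤ → ℝ := fun n => formSymbol ε ω κ (blochPoint σ n)
  have hq : ∀ n, (q n : ℂ) ≠ 0 := fun n => by exact_mod_cast (formSymbol_pos hκ1 _).ne'
  have hqw : ∀ n, blochWeight ε ω κ σ n = (q n)⁻¹ := fun n => rfl
  -- The coefficients are chosen so that N²h is the trigonometric polynomial with coefficients a.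
  let h : L2Circle := ∑ n ∈ S, ((q n : ℂ) ^ 2 * a n) • e n
  have hN1 : circleN ε ω κ σ h = ∑ n ∈ S, ((q n : ℂ) * a n) • e n := by
    simp only [h, map_sum, map_smul]
    refine Finset.sum_congr rfl fun n _ => ?_
    rw [circleN, diagOp_basis _ hsum, smul_smul, hqw]
    congr 1
    have := hq n
    push_cast
    field_simp
  have hN2 : circleN ε ω κ σ (circleN ε ω κ σ h) = ∑ n ∈ S, a n • e n := by
    rw [hN1]
    simp only [map_sum, map_smul]
    refine Finset.sum_congr rfl fun n _ => ?_
    rw [circleN, diagOp_basis _ hsum, smul_smul, hqw]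
    congr 1
    have := hq n
    push_cast
    field_simp
  have hnorm : ∀ c : ℤ → ℂ, ‖∑ n ∈ S, c n • e n‖ ^ 2 = ∑ n ∈ S, ‖c n‖ ^ 2 := fun c => by
    rw [← re_inner_self, e.orthonormal.inner_sum, Complex.re_sum]
    refine Finset.sum_congr rfl fun n _ => ?_
    rw [Complex.conj_mul']
    norm_cast
  have hVW : inner ℂ (∑ n ∈ S, a n • e n) (circleV s b ε u (∑ n ∈ S, a n • e n)) =
      ∑ n ∈ S, ∑ m ∈ S, conj (a n) * a m * potentialCoeff s b ε u (n - m) := by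
    rw [map_sum, sum_inner]
    refine Finset.sum_congr rfl fun n _ => ?_
    rw [inner_sum]
    refine Finset.sum_congr rfl fun m _ => ?_
    rw [map_smul, inner_smul_left, inner_smul_right, hu.inner_circleV_basis]
    ring
  have key := hform h
  rw [hN2, hN1, hnorm, hnorm, hVW] at key
  -- Because q² is the squared plane symbol plus κ, the auxiliary κ drops out of the inequality.
  have h3 : ∑ n ∈ S, ‖(q n : ℂ) * a n‖ ^ 2 =
      ∑ n ∈ S, planeSymbol ε ω (blochPoint σ n) ^ 2 * ‖a n‖ ^ 2 + κ * ∑ n ∈ S, ‖a n‖ ^ 2 := by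
    rw [Finset.mul_sum, ← Finset.sum_add_distrib]
    refine Finset.sum_congr rfl fun n _ => ?_
    rw [norm_mul, mul_pow, Complex.norm_real, Real.norm_eq_abs, sq_abs, formSymbol_sq hκ1]
    ring
  rw [h3] at key
  have h4 : 0 ≤ ∑ n ∈ S, ‖a n‖ ^ 2 := Finset.sum_nonneg fun n _ => sq_nonneg _
  nlinarith [mul_le_mul_of_nonneg_right hμle h4]

theorem norm_fourierCoeffOn_le {f : ℝ → ℂ} {M : ℝ} (hM : ∀ x, ‖f x‖ ≤ M) (n : ℤ) :
    ‖fourierCoeffOn Real.two_pi_pos f n‖ ≤ M := by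
  rw [fourierCoeffOn_eq_integral, norm_smul]
  have h := intervalIntegral.norm_integral_le_of_norm_le_const (a := 0) (b := 2 * Real.pi)
    (f := fun x => fourier (T := 2 * Real.pi - 0) (-n) (x : AddCircle (2 * Real.pi - 0)) • f x)
    (C := M) fun x _ => by
      rw [norm_smul, fourier_apply, Circle.norm_coe, one_mul]
      exact hM x
  rw [sub_zero, abs_of_pos Real.two_pi_pos] at h
  have hpi := Real.two_pi_pos
  rw [sub_zero, Real.norm_of_nonneg (by positivity), one_div, inv_mul_le_iff₀ hpi]
  linarith

/-- Two integrations by parts, with boundary terms cancelled by periodicity, each give a factor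
1/|n|. -/
theorem norm_fourierCoeffOn_le_of_deriv {f f' f'' : ℝ → ℂ} (hf : ∀ x, HasDerivAt f (f' x) x)
    (hf' : ∀ x, HasDerivAt f' (f'' x) x) (hc : Continuous f'')
    (hp : Function.Periodic f (2 * Real.pi)) (hp' : Function.Periodic f' (2 * Real.pi))
    {M : ℝ} (hM : ∀ x, ‖f'' x‖ ≤ M) {n : ℤ} (hn : n ≠ 0) :
    ‖fourierCoeffOn Real.two_pi_pos f n‖ ≤ M * (1 / (n : ℝ) ^ 2) := by
  have hc' : Continuous f' := continuous_iff_continuousAt.2 fun x => (hf' x).continuousAt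
  have aux : ∀ {g g' : ℝ → ℂ}, (∀ x, HasDerivAt g (g' x) x) → Continuous g' →
      Function.Periodic g (2 * Real.pi) →
      ‖fourierCoeffOn Real.two_pi_pos g n‖ =
        |(n : ℝ)|⁻¹ * ‖fourierCoeffOn Real.two_pi_pos g' n‖ := fun {g g'} hg hgc hgp => by
    rw [fourierCoeffOn_of_hasDerivAt Real.two_pi_pos hn (fun x _ => hg x)
      (hgc.intervalIntegrable _ _)]
    have h0 : g (2 * Real.pi) = g 0 := by simpa using hgp 0
    have hpi := Real.pi_pos
    rw [h0, sub_self, mul_zero, zero_sub, norm_mul, norm_neg, norm_mul, ← Complex.ofReal_sub,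
      Complex.norm_real, sub_zero, norm_div, norm_mul, norm_mul, norm_mul, norm_neg]
    simp only [norm_one, Complex.norm_ofNat, Complex.norm_real, Complex.norm_I,
      Complex.norm_intCast,
      Real.norm_eq_abs, abs_of_pos hpi, abs_of_pos Real.two_pi_pos]
    field_simp
  rw [aux hf hc' hp, aux hf' hc hp', ← mul_assoc, ← mul_inv, ← sq, sq_abs, mul_comm, one_div]
  gcongr
  exact norm_fourierCoeffOn_le hM n

/-- The potential is C², so its coefficients are O(n⁻²). Summability gives norm convergence of the
modulation series and convergence of the window averages. -/
theorem IsRoll.summable_potentialCoeff (hu : IsRoll s b ε ω u) :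
    Summable (potentialCoeff s b ε u) := by
  have hV : ContDiff ℝ 2 fun x => (potential s b ε u x : ℂ) := by
    have h1 : ContDiff ℝ 2 u := hu.contDiff.of_le (by norm_num)
    have h2 : ContDiff ℝ 2 (potential s b ε u) := by
      unfold potential
      fun_prop
    exact Complex.ofRealCLM.contDiff.comp h2
  set f : ℝ → ℂ := fun x => (potential s b ε u x : ℂ) with hf
  have hp : Function.Periodic f (2 * Real.pi) := fun x => by
    simp only [hf, hu.periodic_potential x]
  have hV1 : ContDiff ℝ 1 (deriv f) := by
    have : ContDiff ℝ (1 + 1) f := by simpa [one_add_one_eq_two] using hV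
    exact (contDiff_succ_iff_deriv.1 this).2.2
  have hd1 : ∀ x, HasDerivAt f (deriv f x) x := fun x =>
    (hV.differentiable (by norm_num) x).hasDerivAt
  have hd2 : ∀ x, HasDerivAt (deriv f) (deriv (deriv f) x) x := fun x =>
    (hV1.differentiable (by norm_num) x).hasDerivAt
  have hc : Continuous (deriv (deriv f)) := hV1.continuous_deriv le_rfl
  have hpd : ∀ g : ℝ → ℂ, Function.Periodic g (2 * Real.pi) →
      Function.Periodic (deriv g) (2 * Real.pi) := fun g hg x => by
    rw [← deriv_comp_add_const]
    congr 1
    exact funext hg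
  have hpp := hpd _ (hpd _ hp)
  obtain ⟨M, hM⟩ := isCompact_Icc.exists_bound_of_continuousOn
    (s := Set.Icc (0 : ℝ) (2 * Real.pi)) hc.continuousOn
  have hM' : ∀ x, ‖deriv (deriv f) x‖ ≤ M := fun x => by
    obtain ⟨y, hy, hxy⟩ := hpp.exists_mem_Ico₀ Real.two_pi_pos x
    rw [hxy]
    exact hM y ⟨hy.1, hy.2.le⟩
  refine Summable.of_norm_bounded_eventually
    (((Real.summable_one_div_int_pow (p := 2)).2 one_lt_two).mul_left M) ?_
  filter_upwards [(Set.finite_singleton (0 : ℤ)).compl_mem_cofinite] with n hn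
  have h1 : potentialCoeff s b ε u n = fourierCoeffOn Real.two_pi_pos f n := by
    have h2 := fourierCoeff_liftIco_eq (T := 2 * Real.pi) (a := 0) f n
    have h3 : (fun θ => (circlePotential s b ε u θ : ℂ)) =
        AddCircle.liftIco (2 * Real.pi) 0 f := rfl
    rw [potentialCoeff, h3, h2]
    simp only [zero_add]
  rw [h1]
  exact norm_fourierCoeffOn_le_of_deriv hd1 hd2 hc hp (hpd _ hp) hM' hn

end BlochSpectrum

end SwiftHohenberg

namespace SwiftHohenberg

open scoped BoundedContinuousFunction ComplexConjugate FourierTransform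

/-! ### Averages over windows of lattice points -/

/-- Enlarging the window from K to K + 1 adds one row, one column and the corner, whose sum is the
symmetric partial sum of t over |j| ≤ K. The double sum is therefore a sum of partial sums, and
Cesàro's theorem applies. -/
theorem tendsto_window_average {t : ℤ → ℂ} (ht : Summable t) :
    Tendsto (fun K : ℕ => (K : ℝ)⁻¹ • ∑ n ∈ Finset.range K, ∑ m ∈ Finset.range K,
      t ((n : ℤ) - m)) atTop (𝓝 (∑' j, t j)) := by
  let d : ℕ → ℂ := fun K => ∑ i ∈ Finset.range (K + 1), t i +
    ∑ i ∈ Finset.range K, t (-((i : ℤ) + 1))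
  have hnat : Summable fun i : ℕ => t i := ht.comp_injective Nat.cast_injective
  have hneg : Summable fun i : ℕ => t (-((i : ℤ) + 1)) :=
    ht.comp_injective fun a b h => by simpa using h
  have hd : Tendsto d atTop (𝓝 (∑' j, t j)) := by
    rw [tsum_of_nat_of_neg_add_one hnat hneg]
    exact (hnat.hasSum.tendsto_sum_nat.comp (tendsto_add_atTop_nat 1)).add
      hneg.hasSum.tendsto_sum_nat
  have hsum : ∀ K : ℕ, ∑ n ∈ Finset.range K, ∑ m ∈ Finset.range K, t ((n : ℤ) - m) =
      ∑ i ∈ Finset.range K, d i := fun K => by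
    induction K with
    | zero => simp
    | succ K ih =>
      rw [Finset.sum_range_succ (fun i => d i), ← ih, Finset.sum_range_succ]
      simp only [Finset.sum_range_succ _ K, Finset.sum_add_distrib]
      have h1 : ∑ n ∈ Finset.range K, t ((n : ℤ) - K) =
          ∑ i ∈ Finset.range K, t (-((i : ℤ) + 1)) := by
        rw [← Finset.sum_range_reflect]
        refine Finset.sum_congr rfl fun i hi => ?_
        have := Finset.mem_range.1 hi
        congr 1
        omega
      have h2 : ∑ m ∈ Finset.range K, t ((K : ℤ) - m) + t ((K : ℤ) - K) =
          ∑ i ∈ Finset.range (K + 1), t i := by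
        rw [← Finset.sum_range_succ (fun m : ℕ => t ((K : ℤ) - m)), ← Finset.sum_range_reflect]
        refine Finset.sum_congr rfl fun i hi => ?_
        have := Finset.mem_range.1 hi
        congr 1
        omega
      rw [h1, h2]
      simp only [d]
      ring
  simp only [hsum]
  exact hd.cesaro_smul

/-! ### Modulation and translation -/

/-- The bounded continuous function `exp (i j x)` on the plane. -/
def modulation (j : ℤ) : Plane →ᵇ ℂ :=
  BoundedContinuousFunction.ofNormedAddCommGroup
    (fun z : Plane => fourier (T := 2 * Real.pi) j ((z 0 : ℝ) : Circle2Pi))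
    ((fourier j).continuous.comp ((AddCircle.continuous_mk' _).comp (by fun_prop))) 1
    (fun z => by rw [fourier_apply, Circle.norm_coe])

theorem modulation_apply (j : ℤ) (z : Plane) :
    modulation j z = fourier (T := 2 * Real.pi) j ((z 0 : ℝ) : Circle2Pi) := rfl

/-- The shift in frequency corresponding to multiplication by `exp (i x)`. -/
def frequencyShift : Plane := EuclideanSpace.single 0 (1 / (2 * Real.pi))

theorem fourierChar_inner_frequencyShift (j : ℤ) (z : Plane) :
    (Real.fourierChar (inner ℝ ((j : ℝ) • frequencyShift) z) : ℂ) = modulation j z := by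
  rw [modulation_apply, fourier_coe_apply, Real.fourierChar_apply, inner_smul_left, frequencyShift,
    EuclideanSpace.inner_single_left]
  congr 1
  have : (Real.pi : ℂ) ≠ 0 := by exact_mod_cast Real.pi_ne_zero
  simp
  field_simp

theorem fourierInv_compSubConst (ψ : 𝓢(Plane, ℂ)) (j : ℤ) (x : Plane) :
    𝓕⁻ (ψ.compSubConstCLM ℂ ((j : ℝ) • frequencyShift)) x = modulation j x * 𝓕⁻ ψ x := by
  rw [SchwartzMap.fourierInv_coe, SchwartzMap.fourierInv_coe, Real.fourierInv_eq,
    Real.fourierInv_eq, ← fourierChar_inner_frequencyShift, ← integral_const_mul]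
  symm
  rw [← integral_sub_right_eq_self _ ((j : ℝ) • frequencyShift)]
  refine integral_congr_ae (Eventually.of_forall fun v => ?_)
  simp only [SchwartzMap.compSubConstCLM_apply]
  rw [Circle.smul_def, Circle.smul_def, smul_eq_mul, smul_eq_mul, ← mul_assoc,
    ← Circle.coe_mul, ← AddChar.map_add_eq_mul, ← inner_add_left]
  congr 4
  abel

/-- Translation on `L²(ℝ²)`. -/
def translation (η : Plane) : L2Plane →ₗᵢ[ℂ] L2Plane :=
  Lp.compMeasurePreservingₗᵢ ℂ (fun ξ => ξ - η) (measurePreserving_sub_right volume η)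

theorem coeFn_translation (η : Plane) (g : L2Plane) :
    translation η g =ᵐ[volume] fun ξ => g (ξ - η) :=
  Lp.coeFn_compMeasurePreserving g (measurePreserving_sub_right volume η)

/-- On Schwartz functions this is a change of variables in the Fourier integral; both sides are
continuous on L², so density finishes. -/
theorem fourierInv_translation (j : ℤ) (g : L2Plane) :
    𝓕⁻ (translation ((j : ℝ) • frequencyShift) g) = mulOp volume (modulation j) (𝓕⁻ g) := by
  refine DenseRange.induction_on
    (p := fun g : L2Plane => 𝓕⁻ (translation ((j : ℝ) • frequencyShift) g) =
      mulOp volume (modulation j) (𝓕⁻ g))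
    (SchwartzMap.denseRange_toLpCLM (E := Plane) (F := ℂ) (p := 2) (μ := volume)
      ENNReal.ofNat_ne_top) g ?_ ?_
  · refine isClosed_eq ?_ ?_
    · exact (Lp.fourierTransformₗᵢ Plane ℂ).symm.continuous.comp (translation _).continuous
    · exact (mulOp volume (modulation j)).continuous.comp
        (Lp.fourierTransformₗᵢ Plane ℂ).symm.continuous
  · intro ψ
    rw [SchwartzMap.toLpCLM_apply]
    have h1 : translation ((j : ℝ) • frequencyShift) (ψ.toLp 2) =
        (ψ.compSubConstCLM ℂ ((j : ℝ) • frequencyShift)).toLp 2 := by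
      refine Lp.ext ?_
      have h2 := ψ.coeFn_toLp 2 (volume : Measure Plane)
      have h3 := (measurePreserving_sub_right (volume : Measure Plane)
        ((j : ℝ) • frequencyShift)).quasiMeasurePreserving.ae h2
      filter_upwards [coeFn_translation ((j : ℝ) • frequencyShift) (ψ.toLp 2), h3,
        (ψ.compSubConstCLM ℂ ((j : ℝ) • frequencyShift)).coeFn_toLp 2 (volume : Measure Plane)]
        with ξ h4 h5 h6
      rw [h4, h5, h6, SchwartzMap.compSubConstCLM_apply]
    rw [h1, SchwartzMap.toLp_fourierInv_eq, SchwartzMap.toLp_fourierInv_eq]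
    refine Lp.ext ?_
    filter_upwards [coeFn_mulOp (modulation j) ((𝓕⁻ ψ).toLp 2 : L2Plane),
      (𝓕⁻ ψ).coeFn_toLp 2 (volume : Measure Plane),
      (𝓕⁻ (ψ.compSubConstCLM ℂ ((j : ℝ) • frequencyShift))).coeFn_toLp 2
        (volume : Measure Plane)] with x h4 h5 h6
    rw [h4, h5, h6, fourierInv_compSubConst]

theorem fourier_modulation (j : ℤ) (f : L2Plane) :
    𝓕 (mulOp volume (modulation j) f) = translation ((j : ℝ) • frequencyShift) (𝓕 f) := by
  have h := fourierInv_translation j (𝓕 f)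
  rw [FourierTransform.fourierInv_fourier_eq] at h
  rw [← h, FourierTransform.fourier_fourierInv_eq]

theorem inner_modulation_eq_integral (j : ℤ) (w : L2Plane) :
    inner ℂ w (mulOp volume (modulation j) w) =
      ∫ ξ, conj ((𝓕 w : L2Plane) ξ) * (𝓕 w : L2Plane) (ξ - (j : ℝ) • frequencyShift) := by
  rw [← Lp.inner_fourier_eq, fourier_modulation, L2.inner_def]
  refine integral_congr_ae ?_
  filter_upwards [coeFn_translation ((j : ℝ) • frequencyShift) (𝓕 w)] with ξ h
  rw [h, RCLike.inner_apply, mul_comm]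

end SwiftHohenberg

namespace SwiftHohenberg

open scoped BoundedContinuousFunction ComplexConjugate FourierTransform

/-! ### The form inequality on the plane -/

section FormInequality

variable {s b ε ω κ C : ℝ} {u : ℝ → ℝ}

/-- The series converges in the sup norm because modulations have norm at most 1; its sum is
identified pointwise by the Fourier series on the circle. -/
theorem IsRoll.hasSum_modulation (hu : IsRoll s b ε ω u) :
    HasSum (fun j => potentialCoeff s b ε u j • modulation j)
      (realBCF fun z : Plane => potential s b ε u (z 0)) := by
  have hs : Summable fun j => potentialCoeff s b ε u j • modulation j := by
    refine Summable.of_norm_bounded hu.summable_potentialCoeff.norm fun j => ?_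
    rw [norm_smul]
    refine mul_le_of_le_one_right (norm_nonneg _) ?_
    exact BoundedContinuousFunction.norm_ofNormedAddCommGroup_le _ zero_le_one _
  convert! hs.hasSum
  ext z
  let f : C(Circle2Pi, ℂ) := ⟨fun θ => (circlePotential s b ε u θ : ℂ),
    Complex.continuous_ofReal.comp hu.continuous_circlePotential⟩
  have hf : Summable (fourierCoeff f) := hu.summable_potentialCoeff
  have h1 := has_pointwise_sum_fourier_series_of_summable hf ((z 0 : ℝ) : Circle2Pi)
  have h2 := hs.hasSum.mapL (BoundedContinuousFunction.evalCLM ℂ z)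
  have h3 := h1.unique h2
  rw [hu.planePotential_apply, ← hu.circlePotential_coe]
  exact h3

theorem IsRoll.hasSum_inner_planeV (hu : IsRoll s b ε ω u) (w : L2Plane) :
    HasSum (fun j => potentialCoeff s b ε u j * inner ℂ w (mulOp volume (modulation j) w))
      (inner ℂ w (planeV s b ε u w)) := by
  have h := ((hu.hasSum_modulation.mapL (mulOp (volume : Measure Plane))).mapL
    (ContinuousLinearMap.apply ℂ L2Plane w)).mapL (innerSL ℂ w)
  simpa [planeV, inner_smul_right] using h

/-- For σ = 2πξ the frequencies seen by B(σ) are the lattice translates of ξ, so the Bloch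
inequality is a pointwise statement about values of ŵ along this lattice. -/
theorem blochPoint_eq_add (ξ : Plane) (n : ℤ) :
    blochPoint (2 * Real.pi * ξ 0, 2 * Real.pi * ξ 1) n = ξ + (n : ℝ) • frequencyShift := by
  have hpi := Real.pi_ne_zero
  ext i
  fin_cases i
  · simp [blochPoint, frequencyShift]
    field_simp
    ring
  · simp [blochPoint, frequencyShift]

/-- Translation invariance of Lebesgue measure leaves only the difference n - m, and shifting the
frequency is modulating the function. -/
theorem integral_conj_mul_translate (w : L2Plane) (n m : ℤ) :
    ∫ ξ, conj ((𝓕 w : L2Plane) (ξ + (n : ℝ) • frequencyShift)) *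
      (𝓕 w : L2Plane) (ξ + (m : ℝ) • frequencyShift) =
      inner ℂ w (mulOp volume (modulation (n - m)) w) := by
  rw [inner_modulation_eq_integral]
  symm
  rw [← integral_add_right_eq_self _ ((n : ℝ) • frequencyShift)]
  refine integral_congr_ae (Eventually.of_forall fun ξ => ?_)
  simp only
  congr 2
  push_cast
  rw [sub_smul]
  abel

theorem integral_norm_sq_eq (f : L2Plane) : ∫ ξ, ‖f ξ‖ ^ 2 = ‖f‖ ^ 2 := by
  rw [← re_inner_self, L2.inner_def, ← RCLike.re_eq_complex_re,
    ← integral_re (L2.integrable_inner f f)]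
  refine integral_congr_ae (Eventually.of_forall fun ξ => ?_)
  simp only
  rw [inner_self_eq_norm_sq]

/-- Integration of a pointwise inequality between finitely many translates. -/
theorem integral_window_le {G : Plane → ℂ} (hG : MemLp G 2 (volume : Measure Plane)) {A : Plane → ℝ}
    (hA : Integrable fun ξ => A ξ * ‖G ξ‖ ^ 2) (τ : ℕ → Plane) (c : ℕ → ℕ → ℂ) (lam : ℝ) (K : ℕ)
    (hpt : ∀ ξ : Plane,
      (∑ n ∈ Finset.range K, ∑ m ∈ Finset.range K,
        conj (G (ξ + τ n)) * G (ξ + τ m) * c n m).re -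
        ∑ n ∈ Finset.range K, A (ξ + τ n) * ‖G (ξ + τ n)‖ ^ 2 ≤
      lam * ∑ n ∈ Finset.range K, ‖G (ξ + τ n)‖ ^ 2) :
    (∑ n ∈ Finset.range K, ∑ m ∈ Finset.range K,
      c n m * ∫ ξ, conj (G (ξ + τ n)) * G (ξ + τ m)).re ≤
      K * (lam * (∫ ξ, ‖G ξ‖ ^ 2) + ∫ ξ, A ξ * ‖G ξ‖ ^ 2) := by
  have hτ : ∀ n, MemLp (fun ξ => G (ξ + τ n)) 2 (volume : Measure Plane) := fun n =>
    hG.comp_measurePreserving (measurePreserving_add_right volume (τ n))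
  have hi1 : ∀ n m, Integrable fun ξ => conj (G (ξ + τ n)) * G (ξ + τ m) * c n m := fun n m => by
    have h2 : MemLp (fun ξ => conj (G (ξ + τ n))) 2 (volume : Measure Plane) := (hτ n).star
    exact (h2.integrable_mul (hτ m)).mul_const _
  have hi2 : ∀ n, Integrable fun ξ => A (ξ + τ n) * ‖G (ξ + τ n)‖ ^ 2 :=
    fun n => hA.comp_add_right (τ n)
  have hi3 : ∀ n, Integrable fun ξ => ‖G (ξ + τ n)‖ ^ 2 := fun n =>
    (hτ n).integrable_norm_pow two_ne_zero
  have hI1 : Integrable fun ξ => ∑ n ∈ Finset.range K, ∑ m ∈ Finset.range K,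
      conj (G (ξ + τ n)) * G (ξ + τ m) * c n m :=
    integrable_finsetSum _ fun n _ => integrable_finsetSum _ fun m _ => hi1 n m
  have hI1r : Integrable fun ξ => (∑ n ∈ Finset.range K, ∑ m ∈ Finset.range K,
      conj (G (ξ + τ n)) * G (ξ + τ m) * c n m).re := hI1.re
  have hI2 : Integrable fun ξ => ∑ n ∈ Finset.range K,
      A (ξ + τ n) * ‖G (ξ + τ n)‖ ^ 2 := integrable_finsetSum _ fun n _ => hi2 n
  have hI3 : Integrable fun ξ => ∑ n ∈ Finset.range K, ‖G (ξ + τ n)‖ ^ 2 :=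
    integrable_finsetSum _ fun n _ => hi3 n
  have hmono := integral_mono (hI1r.sub hI2) (hI3.const_mul lam) hpt
  have e1 : ∫ ξ, (∑ n ∈ Finset.range K, ∑ m ∈ Finset.range K,
      conj (G (ξ + τ n)) * G (ξ + τ m) * c n m).re =
      (∑ n ∈ Finset.range K, ∑ m ∈ Finset.range K,
        c n m * ∫ ξ, conj (G (ξ + τ n)) * G (ξ + τ m)).re := by
    have h1 : ∫ ξ, (∑ n ∈ Finset.range K, ∑ m ∈ Finset.range K,
      conj (G (ξ + τ n)) * G (ξ + τ m) * c n m).re = (∫ ξ, ∑ n ∈ Finset.range K,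
        ∑ m ∈ Finset.range K, conj (G (ξ + τ n)) * G (ξ + τ m) * c n m).re := integral_re hI1
    rw [h1, integral_finsetSum _ fun n _ => integrable_finsetSum _ fun m _ => hi1 n m]
    congr 1
    refine Finset.sum_congr rfl fun n _ => ?_
    rw [integral_finsetSum _ fun m _ => hi1 n m]
    refine Finset.sum_congr rfl fun m _ => ?_
    rw [integral_mul_const, mul_comm]
  have e2 : ∫ ξ, ∑ n ∈ Finset.range K, A (ξ + τ n) * ‖G (ξ + τ n)‖ ^ 2 =
      K * ∫ ξ, A ξ * ‖G ξ‖ ^ 2 := by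
    rw [integral_finsetSum _ fun n _ => hi2 n]
    simp only [integral_add_right_eq_self fun ξ => A ξ * ‖G ξ‖ ^ 2,
      Finset.sum_const, Finset.card_range, nsmul_eq_mul]
  have e3 : ∫ ξ, ∑ n ∈ Finset.range K, ‖G (ξ + τ n)‖ ^ 2 = K * ∫ ξ, ‖G ξ‖ ^ 2 := by
    rw [integral_finsetSum _ fun n _ => hi3 n]
    simp only [integral_add_right_eq_self fun ξ => ‖G ξ‖ ^ 2,
      Finset.sum_const, Finset.card_range, nsmul_eq_mul]
  have hsub := integral_sub hI1r hI2
  have hmono' : ∫ ξ, (∑ n ∈ Finset.range K, ∑ m ∈ Finset.range K,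
      conj (G (ξ + τ n)) * G (ξ + τ m) * c n m).re -
      ∑ n ∈ Finset.range K, A (ξ + τ n) * ‖G (ξ + τ n)‖ ^ 2 ≤
      ∫ ξ, lam * ∑ n ∈ Finset.range K, ‖G (ξ + τ n)‖ ^ 2 := hmono
  rw [hsub, e1, e2, integral_const_mul, e3] at hmono'
  linarith

/-- The frequency window estimate: the Bloch form inequality integrated over all frequencies. -/
theorem IsRoll.window_form_le (hu : IsRoll s b ε ω u) (hk : 0 < 1 + 2 * ε * ω) (w : L2Plane)
    (hA : Integrable fun ξ => planeSymbol ε ω ξ ^ 2 * ‖(𝓕 w : L2Plane) ξ‖ ^ 2) (K : ℕ) :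
    (∑ n ∈ Finset.range K, ∑ m ∈ Finset.range K, potentialCoeff s b ε u ((n : ℤ) - m) *
        inner ℂ w (mulOp volume (modulation ((n : ℤ) - m)) w)).re ≤
      K * (maxGrowthRate s b ε ω u * ‖w‖ ^ 2 +
        ∫ ξ, planeSymbol ε ω ξ ^ 2 * ‖(𝓕 w : L2Plane) ξ‖ ^ 2) := by
  have h := integral_window_le (Lp.memLp (𝓕 w : L2Plane)) (A := fun ξ => planeSymbol ε ω ξ ^ 2) hA
    (fun n => ((n : ℤ) : ℝ) • frequencyShift)
    (fun n m => potentialCoeff s b ε u ((n : ℤ) - m)) (maxGrowthRate s b ε ω u) K fun ξ => by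
      -- Here ξ ranges over the whole plane and not over one Brillouin zone, so every frequency is
      -- counted K times.
      have h := hu.finite_bloch_form_le hk (2 * Real.pi * ξ 0, 2 * Real.pi * ξ 1)
        ((Finset.range K).map Nat.castEmbedding)
        (fun n => (𝓕 w : L2Plane) (ξ + (n : ℝ) • frequencyShift))
      simpa only [Finset.sum_map, Nat.castEmbedding_apply, blochPoint_eq_add] using h
  simp only [integral_conj_mul_translate, integral_norm_sq_eq, Lp.norm_fourier_eq] at h
  exact h

/-- The quadratic form of the linearized operator is bounded by the maximal growth rate. -/
theorem IsRoll.plane_form_le (hu : IsRoll s b ε ω u) (hk : 0 < 1 + 2 * ε * ω) (hκ : 1 ≤ κ)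
    (h : L2Plane) :
    (κ - maxGrowthRate s b ε ω u) * ‖planeN ε ω κ (planeN ε ω κ h)‖ ^ 2 ≤
      ‖planeN ε ω κ h‖ ^ 2 - (inner ℂ (planeN ε ω κ (planeN ε ω κ h))
        (planeV s b ε u (planeN ε ω κ (planeN ε ω κ h)))).re := by
  set v := planeN ε ω κ h
  set w := planeN ε ω κ v with hw
  -- Here v = N⁻¹w, so |v̂|² = (a² + κ)|ŵ|², which also shows that a²|ŵ|² is integrable.
  have hae : ∀ᵐ ξ : Plane, ‖(𝓕 v : L2Plane) ξ‖ ^ 2 =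
      planeSymbol ε ω ξ ^ 2 * ‖(𝓕 w : L2Plane) ξ‖ ^ 2 + κ * ‖(𝓕 w : L2Plane) ξ‖ ^ 2 := by
    have h1 := coeFn_mulOp (realBCF fun ξ => (formSymbol ε ω κ ξ)⁻¹) (𝓕 v : L2Plane)
    rw [← fourier_fourierMul] at h1
    filter_upwards [h1] with ξ h2
    have h3 := formSymbol_pos (ε := ε) (ω := ω) hκ ξ
    rw [hw, planeN, h2, realBCF_apply (continuous_inv_formSymbol hκ) (abs_inv_formSymbol_le hκ),
      norm_mul, Complex.norm_real, Real.norm_of_nonneg (inv_nonneg.2 h3.le), ← add_mul,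
      ← formSymbol_sq hκ]
    field_simp
  have hiv : Integrable fun ξ => ‖(𝓕 v : L2Plane) ξ‖ ^ 2 :=
    (Lp.memLp (𝓕 v : L2Plane)).integrable_norm_pow two_ne_zero
  have hiw : Integrable fun ξ => ‖(𝓕 w : L2Plane) ξ‖ ^ 2 :=
    (Lp.memLp (𝓕 w : L2Plane)).integrable_norm_pow two_ne_zero
  have hA : Integrable fun ξ => planeSymbol ε ω ξ ^ 2 * ‖(𝓕 w : L2Plane) ξ‖ ^ 2 := by
    refine (hiv.sub (hiw.const_mul κ)).congr ?_
    filter_upwards [hae] with ξ h1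
    simp only [Pi.sub_apply, h1]
    ring
  have hv : ‖v‖ ^ 2 = (∫ ξ, planeSymbol ε ω ξ ^ 2 * ‖(𝓕 w : L2Plane) ξ‖ ^ 2) + κ * ‖w‖ ^ 2 := by
    rw [← Lp.norm_fourier_eq v, ← integral_norm_sq_eq, integral_congr_ae hae,
      integral_add hA (hiw.const_mul κ), integral_const_mul, integral_norm_sq_eq,
      Lp.norm_fourier_eq]
  have hsum := hu.hasSum_inner_planeV w
  have hlim := (Complex.continuous_re.tendsto _).comp (tendsto_window_average hsum.summable)
  rw [hsum.tsum_eq] at hlim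
  have hle : (inner ℂ w (planeV s b ε u w)).re ≤ maxGrowthRate s b ε ω u * ‖w‖ ^ 2 +
      ∫ ξ, planeSymbol ε ω ξ ^ 2 * ‖(𝓕 w : L2Plane) ξ‖ ^ 2 := by
    refine le_of_tendsto hlim ?_
    filter_upwards [eventually_gt_atTop 0] with K hK
    have hK0 : (0 : ℝ) < K := by exact_mod_cast hK
    simp only [Function.comp_apply, Complex.smul_re, smul_eq_mul]
    rw [inv_mul_le_iff₀ hK0]
    exact hu.window_form_le hk w hA K
  rw [hv]
  linarith

end FormInequality

/-! ### Identification of the linearized semigroup -/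

section Main

variable {s b ε ω : ℝ} {u : ℝ → ℝ}

/-- The linearized semigroup is the one generated by `κ - R⁻¹` with `R = (κ - ℒ)⁻¹`. -/
theorem IsRoll.isLinearizedSemigroup_iff (hu : IsRoll s b ε ω u) (hk : 0 < 1 + 2 * ε * ω)
    {κ : ℝ} (hκ : 1 ≤ κ) (hNV : ‖planeV s b ε u‖ * ‖planeN ε ω κ‖ ^ 2 ≤ 1 / 2)
    {T : ℝ≥0 → L2Plane →L[ℂ] L2Plane} :
    IsLinearizedSemigroup s b ε ω u T ↔
      T = shiftedHeatSemigroup (perturbedResolvent (planeN ε ω κ) (planeV s b ε u)) κ := by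
  have hR := perturbedResolvent_nonneg (isSelfAdjoint_planeN (ε := ε) (ω := ω) (κ := κ))
    (isSelfAdjoint_planeV (s := s) (b := b) (ε := ε) (u := u)) hNV
  have hd := denseRange_of_isSelfAdjoint (IsSelfAdjoint.of_nonneg hR)
    (injective_perturbedResolvent (injective_planeN hκ) hNV)
  have hgraph : ∀ w g, LinearizedGraph s b ε ω u w g ↔
      w = perturbedResolvent (planeN ε ω κ) (planeV s b ε u) ((κ : ℂ) • w - g) := fun w g => by
    rw [hu.linearizedGraph_iff hk hκ, eq_perturbedResolvent_iff hNV]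
  constructor
  · rintro ⟨hT, hgen⟩
    exact eq_shiftedHeatSemigroup hR hd hT fun w g => (hgen w g).trans (hgraph w g)
  · rintro rfl
    exact ⟨isC0Semigroup_shiftedHeatSemigroup hR hd κ, fun w g =>
      (generatorGraph_shiftedHeatSemigroup_iff hR hd).trans (hgraph w g).symm⟩

end Main

end SwiftHohenberg

end

theorem lemma3p2 (s b ε ω : ℝ) (hsb : 0 < 27 * s - 38 * b ^ 2) (hb : b ≠ 0)
    (hε : 0 < ε) (hω : ω ∈ Set.Ioo (-(1 / 2) : ℝ) (1 / 2)) (hk : 0 < 1 + 2 * ε * ω)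
    (u : ℝ → ℝ) (hu : SwiftHohenberg.IsRoll s b ε ω u) :
    IsLUB (SwiftHohenberg.blochEigenvalues s b ε ω u)
        (SwiftHohenberg.maxGrowthRate s b ε ω u) ∧
      (∃ T, SwiftHohenberg.IsLinearizedSemigroup s b ε ω u T) ∧
      ∀ T, SwiftHohenberg.IsLinearizedSemigroup s b ε ω u T →
        ∃ C : ℝ, ∀ (t : ℝ≥0) (w : SwiftHohenberg.L2Plane), SwiftHohenberg.MemH 2 w →
          SwiftHohenberg.MemH 2 (T t w) ∧
          SwiftHohenberg.normH 2 (T t w) ≤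
            C * Real.exp (SwiftHohenberg.maxGrowthRate s b ε ω u * t) *
              SwiftHohenberg.normH 2 w := by
  open SwiftHohenberg in
  obtain ⟨C, hC0, hC⟩ := hu.exists_abs_potential_le
  -- The shift κ = 2C + 1 gives ‖V‖‖N‖² ≤ C/(2C + 1) ≤ 1/2, and it exceeds C, which bounds λ_M.
  have hκ : (1 : ℝ) ≤ 2 * C + 1 := by linarith
  have hNV : ‖planeV s b ε u‖ * ‖planeN ε ω (2 * C + 1)‖ ^ 2 ≤ 1 / 2 :=
    mul_le_half_of_le hC0 le_rfl (hu.norm_planeV_le hC) (sq_nonneg _) (norm_planeN_sq_le hκ)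
  have hlub := hu.isLUB_maxGrowthRate hk
  have hlam : maxGrowthRate s b ε ω u < 2 * C + 1 :=
    (hlub.2 fun μ hμ => hu.blochEigenvalue_le hk hC0 hC hμ).trans_lt (by linarith)
  refine ⟨hlub, ⟨_, (hu.isLinearizedSemigroup_iff hk hκ hNV).2 rfl⟩, fun T hT => ?_⟩
  rw [(hu.isLinearizedSemigroup_iff hk hκ hNV).1 hT]
  obtain ⟨D, hD0, hfrom, hto⟩ := exists_equiv_normH_two (ε := ε) (ω := ω) hk hκ
  -- One D for each passage between the H² norm and the norm of N⁻¹w, and 2 from the growth bound in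
  -- the latter.
  refine ⟨D * 2 * D, fun t w hw => ?_⟩
  obtain ⟨v, rfl, hv⟩ := hfrom w hw
  obtain ⟨v', hv', hle⟩ := exists_shiftedHeatSemigroup_apply_eq isSelfAdjoint_planeN
    (injective_planeN hκ) isSelfAdjoint_planeV hNV hlam (hu.plane_form_le hk hκ) t v
  rw [hv']
  refine ⟨(hto v').1, (hto v').2.trans ?_⟩
  calc D * ‖v'‖ ≤ D * (2 * Real.exp (maxGrowthRate s b ε ω u * t) *
        (D * normH 2 (planeN ε ω (2 * C + 1) v))) := by
        gcongr
        exact hle.trans (by gcongr)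
    _ = _ := by ring
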